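/- Let $K$ be a finite set with at least two elements and let $\kappa$ be the uniform probability measure on $K$. Let $\mathbb F_2=\langle a,b\rangle$ be the free group of rank $2$, with free generators $a,b$, and let $\langle b\rangle$ be the cyclic subgroup generated by $b$. Let $\kappa^{\mathbb F_2/\langle b\rangle}\times\kappa^{\mathbb F_2}$ denote the Borel probability measure on $(K\times K)^{\mathbb F_2}$ that is the push-forward of the product measure on $K^{\mathbb F_2/\langle b\rangle}\times K^{\mathbb F_2}$ under the injection $\Phi(x,y)(g)=(x(g\langle b\rangle),y(g))$. Let $\mathbb F_2$ act on $(K\times K)^{\mathbb F_2}$ by the shift $(g\cdot x)(f)=x(g^{-1}f)$; this action preserves the measure. For a countable group $G$ and a standard probability space $(L,\lambda)$ with $\lambda$ not supported on a single point, the Bernoulli shift over $G$ with base space $(L,\lambda)$ is the action of $G$ on $(L^G,\lambda^G)$ by $(g\cdot x)(h)=x(g^{-1}h)$. Two probability-measure-preserving actions $G_1\curvearrowright(X_1,\mu_1)$ and $G_2\curvearrowright(X_2,\mu_2)$ are stably orbit equivalent if there are measurable sets $A_i\subset X_i$ of positive measure and an isomorphism of measure spaces $\varphi:A_1\to A_2$,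 where $A_i$ carries the conditional probability measure $\mu_i(\cdot\,|A_i)$, such that $\varphi(G_1x\cap A_1)=G_2\varphi(x)\cap A_2$ for almost every $x\in A_1$. Then the shift action of $\mathbb F_2$ on $\bigl((K\times K)^{\mathbb F_2},\ \kappa^{\mathbb F_2/\langle b\rangle}\times\kappa^{\mathbb F_2}\bigr)$ is stably orbit equivalent to some Bernoulli shift over the free group of rank $|K|+1$. -/

import Mathlib

open MeasureTheory ProbabilityTheory

/-- A probability-measure-preserving (p.m.p.) action of a group `G` on a probability
space `(X, μ)`. -/
structure PMPAction (G : Type*) [Group G] {X : Type*} [MeasurableSpace X]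
    (μ : Measure X) [IsProbabilityMeasure μ] where
  /-- `act g` is the transformation of `X` by which `g` acts. -/
  act : G → X → X
  act_one : ∀ x, act 1 x = x
  act_mul : ∀ g h x, act (g * h) x = act g (act h x)
  measurePreserving : ∀ g, MeasurePreserving (act g) μ μ

/-- The orbit of the point `x`. -/
def PMPAction.orbit {G : Type*} [Group G] {X : Type*} [MeasurableSpace X]
    {μ : Measure X} [IsProbabilityMeasure μ] (T : PMPAction G μ) (x : X) : Set X :=
  {x' | ∃ g : G, T.act g x = x'}

/-- The conditional probability measure `E ↦ μ (E ∩ A) / μ A`, as a measure on the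
subspace `A`. -/
noncomputable def condMeasureOn {X : Type*} [MeasurableSpace X] (μ : Measure X) (A : Set X) :
    Measure A :=
  (ProbabilityTheory.cond μ A).comap Subtype.val

/-- Stable orbit equivalence of two p.m.p. actions: there are measurable sets `A₁`, `A₂` of
positive measure and an isomorphism `φ` of the measure spaces `A₁` and `A₂`, with their
conditional measures, which for almost every `x ∈ A₁` maps the part in `A₁` of the orbit of `x`
onto the part in `A₂` of the orbit of `φ x`. (Null sets may be discarded from `A₁` and `A₂`, so
that `φ` may be taken to be an everywhere defined Borel isomorphism.) -/
def StablyOrbitEquivalent {G₁ G₂ : Type*} [Group G₁] [Group G₂]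
    {X₁ X₂ : Type*} [MeasurableSpace X₁] [MeasurableSpace X₂]
    {μ₁ : Measure X₁} {μ₂ : Measure X₂} [IsProbabilityMeasure μ₁] [IsProbabilityMeasure μ₂]
    (T : PMPAction G₁ μ₁) (S : PMPAction G₂ μ₂) : Prop :=
  ∃ (A₁ : Set X₁) (A₂ : Set X₂),
    MeasurableSet A₁ ∧ MeasurableSet A₂ ∧ 0 < μ₁ A₁ ∧ 0 < μ₂ A₂ ∧
    ∃ φ : A₁ ≃ᵐ A₂,
      MeasurePreserving φ (condMeasureOn μ₁ A₁) (condMeasureOn μ₂ A₂) ∧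
      ∀ᵐ x : A₁ ∂(condMeasureOn μ₁ A₁),
        φ '' {x' : A₁ | (x' : X₁) ∈ T.orbit x} = {y : A₂ | (y : X₂) ∈ S.orbit (φ x)}

/-- Permuting the coordinates preserves a power of a probability measure. -/
theorem measurePreserving_reindex {ι K : Type*} [MeasurableSpace K]
    (κ : Measure K) [IsProbabilityMeasure κ] (e : ι ≃ ι) :
    MeasurePreserving (fun (x : ι → K) i => x (e i))
      (Measure.infinitePi fun _ : ι => κ) (Measure.infinitePi fun _ : ι => κ) := by
  have hm : Measurable (fun (x : ι → K) i => x (e i)) := by fun_prop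
  refine ⟨hm, ?_⟩
  refine Measure.eq_infinitePi _ fun s t ht => ?_
  classical
  rw [Measure.map_apply hm (.pi s.countable_toSet fun i _ => ht i)]
  have : (fun (x : ι → K) i => x (e i)) ⁻¹' (Set.pi (s : Set ι) t)
      = Set.pi ((s.map e.toEmbedding : Finset ι) : Set ι) (fun j => t (e.symm j)) := by
    ext x
    simp only [Set.mem_preimage, Set.mem_pi, Finset.mem_coe, Finset.mem_map_equiv]
    exact ⟨fun h j hj => by simpa using h _ hj, fun h i hi => by simpa using h (e i) (by simpa)⟩
  rw [this, Measure.infinitePi_pi _ fun j _ => ht _]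
  simp

/-- The Bernoulli shift over `G` with base space `(K, κ)`: the group `G` acts on `K ^ G` with the
product measure `κ ^ G` by `(g • x) h = x (g⁻¹ h)`. -/
noncomputable def bernoulliShift (G : Type*) [Group G] {K : Type*} [MeasurableSpace K]
    (κ : Measure K) [IsProbabilityMeasure κ] :
    PMPAction G (Measure.infinitePi fun _ : G => κ) where
  act g x := fun h => x (g⁻¹ * h)
  act_one x := by simp
  act_mul g h x := by simp [mul_assoc]
  measurePreserving g := measurePreserving_reindex κ (Equiv.mulLeft g⁻¹)

/-- The cyclic subgroup `⟨b⟩` of the free group `F₂ = ⟨a, b⟩`, where `a` and `b` are the free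
generators with indices `0` and `1`. -/
abbrev subgroupB : Subgroup (FreeGroup (Fin 2)) :=
  Subgroup.zpowers (FreeGroup.of 1)

/-- The injection `Φ` of `K ^ (F₂ / ⟨b⟩) × K ^ F₂` into `(K × K) ^ F₂`,
`Φ (x, y) g = (x (g ⟨b⟩), y g)`. -/
def cosetEmbedding (K : Type*) :
    (FreeGroup (Fin 2) ⧸ subgroupB → K) × (FreeGroup (Fin 2) → K) →
      (FreeGroup (Fin 2) → K × K) :=
  fun p g => (p.1 (g : FreeGroup (Fin 2) ⧸ subgroupB), p.2 g)

theorem measurable_cosetEmbedding (K : Type*) [MeasurableSpace K] :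
    Measurable (cosetEmbedding K) := by
  unfold cosetEmbedding
  fun_prop

/-- The measure `κ ^ (F₂ / ⟨b⟩) × κ ^ F₂`, carried to `(K × K) ^ F₂` by the injection `Φ` (so it
vanishes off the image of `Φ`). -/
noncomputable def cosetMeasure {K : Type*} [MeasurableSpace K] (κ : Measure K)
    [IsProbabilityMeasure κ] : Measure (FreeGroup (Fin 2) → K × K) :=
  ((Measure.infinitePi fun _ : FreeGroup (Fin 2) ⧸ subgroupB => κ).prod
    (Measure.infinitePi fun _ : FreeGroup (Fin 2) => κ)).map (cosetEmbedding K)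

instance {K : Type*} [MeasurableSpace K] (κ : Measure K) [IsProbabilityMeasure κ] :
    IsProbabilityMeasure (cosetMeasure κ) :=
  Measure.isProbabilityMeasure_map (measurable_cosetEmbedding K).aemeasurable

/-- The shift action of `F₂` on `(K × K) ^ F₂` with the measure `κ ^ (F₂ / ⟨b⟩) × κ ^ F₂`. -/
noncomputable def cosetShift {K : Type*} [MeasurableSpace K] (κ : Measure K)
    [IsProbabilityMeasure κ] : PMPAction (FreeGroup (Fin 2)) (cosetMeasure κ) where
  act g x := fun h => x (g⁻¹ * h)
  act_one x := by simp
  act_mul g h x := by simp [mul_assoc]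
  measurePreserving g := by
    have hs : Measurable fun (x : FreeGroup (Fin 2) → K × K) h => x (g⁻¹ * h) := by fun_prop
    have hp := (measurePreserving_reindex κ
      (MulAction.toPerm g⁻¹ : Equiv.Perm (FreeGroup (Fin 2) ⧸ subgroupB))).prod
      (measurePreserving_reindex κ (Equiv.mulLeft g⁻¹))
    refine ⟨hs, ?_⟩
    rw [cosetMeasure, Measure.map_map hs (measurable_cosetEmbedding K)]
    conv_rhs => rw [← hp.map_eq, Measure.map_map (measurable_cosetEmbedding K) hp.measurable]
    rfl

/-! Put n = |K|, identify K with ℤ/n, and let A be the set of labellings, constant in the first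
label on cosets of ⟨b⟩, whose first label at 1 is 0; it has measure 1/n. A point of A is determined
by the increments of its first label along the a-edges together with its second labels. Since κ is
uniform and the Cayley graph is a tree, these data are i.i.d. and uniform on W = (ℤ/n)²
(`map_cosetIncrement_cond`). So A becomes W^F₂ with the Bernoulli measure, and the translate of a
point of A by k lies in A exactly when the cocycle `groupPotential`, with increment d along a-edges
and 0 along b-edges, vanishes at k.

The heart of the proof turns this cocycle into the homomorphism `count` to ℤ/n, a ↦ 0, b ↦ 1,
preserving orbits and measure (`exists_equiv_straightening`). The tool is edge sliding: the tails of
the i-edges are moved along the j-lines by a permutation of each line, chosen equivariantly from its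
labels. The result is another tree on the same vertices, so the orbits stay the same, and the labels
read along it are again i.i.d. (`measurePreserving_slide`). A first slide moves b-edges along
a-lines until each has increment 1. A second slide, in the new tree, moves a-edges along b-lines,
where every step now counts 1, until each has increment 0.

The permutations come from matching two sets of equal measure along the orbits of a skew product of
the shift on W^ℤ with ℤ/n (`exists_matching`, `exists_linePerm`). This requires ergodicity: for the
first slide because d is uniform, for the second because the Bernoulli shift is mixing and the fibre
is rotated by 1.

Returns to A are now translations by the kernel of `count`, which has index n and is free of rank n
+ 1 on b^n and b^k a b^(-k), k < n. Grouping labels over the n cosets makes W^F₂ a Bernoulli shift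
over the kernel with base W^n. -/

/-! ### Walks and branches in the Cayley tree of a free group -/

namespace FreeGroup

/-- Induction on elements of a free group, multiplying by letters on the right. -/
theorem induction_right {α : Type*} {p : FreeGroup α → Prop} (one : p 1)
    (mul_of : ∀ g k, p g → p (g * of k)) (mul_of_inv : ∀ g k, p g → p (g * (of k)⁻¹))
    (g : FreeGroup α) : p g := by
  have hg : g ∈ Subgroup.closure (Set.range (of : α → FreeGroup α)) := by
    rw [closure_range_of]; trivial
  induction hg using Subgroup.closure_induction_right with
  | one => exact one
  | mul_right x y hx hy ih => obtain ⟨k, rfl⟩ := hy; exact mul_of _ _ ih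
  | mul_inv_cancel x y hx hy ih => obtain ⟨k, rfl⟩ := hy; exact mul_of_inv _ _ ih

/-- The endpoint of the walk that starts at `o` and follows the letters of `g` from left to right,
the letter `k` acting by the permutation `A k`. -/
def walk {α Ω : Type*} (A : α → Equiv.Perm Ω) (o : Ω) (g : FreeGroup α) : Ω :=
  -- `lift` gives a left action, in which the last letter would act first; inverting both the word
  -- and the permutations reverses the order.
  lift (fun k => (A k)⁻¹) g⁻¹ o

section walk
variable {α Ω : Type*} (A : α → Equiv.Perm Ω) (o : Ω)

@[simp] theorem walk_one : walk A o 1 = o := by simp [walk]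

theorem walk_mul (g h : FreeGroup α) : walk A o (g * h) = walk A (walk A o g) h := by
  simp [walk, mul_inv_rev]

@[simp] theorem walk_of (k : α) : walk A o (of k) = A k o := by simp [walk]

@[simp] theorem walk_of_inv (k : α) : walk A o (of k)⁻¹ = (A k).symm o := by
  simp [walk]

theorem walk_mul_of (g : FreeGroup α) (k : α) : walk A o (g * of k) = A k (walk A o g) := by
  rw [walk_mul, walk_of]

theorem walk_mul_of_inv (g : FreeGroup α) (k : α) :
    walk A o (g * (of k)⁻¹) = (A k).symm (walk A o g) := by
  rw [walk_mul, walk_of_inv]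

end walk

section startsWith
variable {α : Type*} [DecidableEq α]

theorem mem_startsWith_iff_inv (w : α × Bool) (g : FreeGroup α) :
    g ∈ startsWith w ↔ g⁻¹.toWord.getLast? = some (w.1, !w.2) := by
  rw [toWord_inv, startsWith, Set.mem_ofPred_eq, invRev, List.getLast?_reverse, ← List.head?_eq_getElem?]
  rcases g.toWord with _ | ⟨⟨x, b⟩, l⟩
  · simp
  · obtain ⟨u, v⟩ := w
    simp [Prod.ext_iff]

theorem toWord_getLast?_mk_mul (s : α × Bool) (g : FreeGroup α) (hg : g ≠ 1)
    (hs : mk [s] * g ≠ 1) : (mk [s] * g).toWord.getLast? = g.toWord.getLast? := by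
  have h1 : (mk [s] * g).toWord = reduce (s :: g.toWord) := by
    rw [toWord_mul, toWord_mk, ← reduce_toWord g]
    simp
  have h2 : (mk [s] * g).toWord ≠ [] := by simpa using hs
  rw [h1] at h2 ⊢
  rw [reduce.cons, reduce_toWord] at h2 ⊢
  rcases hw : g.toWord with _ | ⟨t, l⟩
  · exact absurd (toWord_eq_nil_iff.1 hw) hg
  · rw [hw] at h2
    dsimp only at h2 ⊢
    split_ifs at h2 ⊢ with hc
    · rcases l with _ | ⟨u, l⟩
      · exact absurd rfl h2
      · simp
    · simp

/-- Right multiplication by a letter alters only the end of the reduced word. Inversion moves the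
change to the front, where `reduce.cons` computes it. -/
theorem mul_mk_mem_startsWith (w s : α × Bool) (g : FreeGroup α) (hg : g ≠ 1)
    (hs : g * mk [s] ≠ 1) : g * mk [s] ∈ startsWith w ↔ g ∈ startsWith w := by
  rw [mem_startsWith_iff_inv, mem_startsWith_iff_inv, mul_inv_rev, inv_mk]
  have : (invRev [s]) = [(s.1, !s.2)] := rfl
  rw [this, toWord_getLast?_mk_mul _ _ (by simpa using hg)]
  rw [← this, ← inv_mk, ← mul_inv_rev]
  exact inv_ne_one.2 hs

theorem one_notMem_startsWith (w : α × Bool) : (1 : FreeGroup α) ∉ startsWith w := by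
  simp [startsWith]

theorem mk_mem_startsWith (w s : α × Bool) : mk [s] ∈ startsWith w ↔ s = w := by
  simp [startsWith]

/-- The branch of the letter `i`: the reduced words that start with the letter `i`. -/
def branch (i : α) : Set (FreeGroup α) := startsWith (i, true)

theorem one_notMem_branch (i : α) : (1 : FreeGroup α) ∉ branch i := one_notMem_startsWith _

theorem of_mem_branch (i : α) : of i ∈ branch i := (mk_mem_startsWith _ _).2 rfl

theorem mul_of_mem_branch_of_ne {i j : α} (hij : j ≠ i) (g : FreeGroup α) :
    g * of j ∈ branch i ↔ g ∈ branch i := by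
  by_cases hg : g = 1
  · subst hg
    simp only [one_mul, one_notMem_branch, iff_false]
    exact fun h => hij (by simpa using (mk_mem_startsWith _ _).1 h)
  by_cases hs : g * of j = 1
  · have : g = mk [(j, false)] := by
      rw [eq_inv_of_mul_eq_one_left hs]; rfl
    rw [hs, this]
    simp only [one_notMem_branch, false_iff]
    exact fun h => by simpa using (mk_mem_startsWith _ _).1 h
  · exact mul_mk_mem_startsWith _ _ _ hg hs

/-- The edge from 1 to `of i` is the only edge of the tree that joins the branch to its complement.
This explains the excluded point here and in `mul_of_inv_mem_branch`. -/
theorem mul_of_mem_branch {i : α} {g : FreeGroup α} (hg : g ≠ 1) :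
    g * of i ∈ branch i ↔ g ∈ branch i := by
  by_cases hs : g * of i = 1
  · have : g = mk [(i, false)] := by
      rw [eq_inv_of_mul_eq_one_left hs]; rfl
    rw [hs, this]
    simp only [one_notMem_branch, false_iff]
    exact fun h => by simpa using (mk_mem_startsWith _ _).1 h
  · exact mul_mk_mem_startsWith _ _ _ hg hs

theorem mul_of_inv_mem_branch_of_ne {i j : α} (hij : j ≠ i) (g : FreeGroup α) :
    g * (of j)⁻¹ ∈ branch i ↔ g ∈ branch i := by
  rw [← mul_of_mem_branch_of_ne hij, inv_mul_cancel_right]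

theorem mul_zpow_mem_branch_of_ne {i j : α} (hij : j ≠ i) (g : FreeGroup α) (m : ℤ) :
    g * of j ^ m ∈ branch i ↔ g ∈ branch i := by
  induction m using Int.induction_on with
  | zero => simp
  | succ m ih => rw [zpow_add_one, ← mul_assoc, mul_of_mem_branch_of_ne hij, ih]
  | pred m ih => rw [zpow_sub_one, ← mul_assoc, mul_of_inv_mem_branch_of_ne hij, ih]

theorem mul_of_inv_mem_branch {i : α} {g : FreeGroup α} (hg : g ≠ of i) :
    g * (of i)⁻¹ ∈ branch i ↔ g ∈ branch i := by
  rw [← mul_of_mem_branch (fun h => hg (mul_inv_eq_one.1 h)), inv_mul_cancel_right]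

/-- Elements in different cosets of the subgroup generated by the letter `j` are separated by a
translate of the branch of the letter `i`. -/
theorem exists_separating_branch {i j : Fin 2} (hij : j ≠ i) (g : FreeGroup (Fin 2)) :
    g ∈ Subgroup.zpowers (of j) ∨ ∃ u, ¬ (u ∈ branch i ↔ u * g ∈ branch i) := by
  suffices H : ∀ L : List (Fin 2 × Bool), ∀ g : FreeGroup (Fin 2), g.toWord = L →
      g ∈ Subgroup.zpowers (of j) ∨ ∃ u, ¬ (u ∈ branch i ↔ u * g ∈ branch i) from H _ g rfl
  intro L
  induction L with
  | nil => intro g hg; left; rw [toWord_eq_nil_iff.1 hg]; exact one_mem _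
  | cons s L ih =>
    intro g hg
    have hL : (mk L).toWord = L := by
      have h := isReduced_toWord (x := g)
      rw [hg] at h
      rw [toWord_mk]
      exact (h.infix ⟨[s], [], by simp⟩).reduce_eq
    have hgs : g = mk [s] * mk L := by
      rw [mul_mk, ← mk_toWord (x := g), hg]; rfl
    obtain ⟨k, ε⟩ := s
    by_cases hk : k = i
    · subst hk
      right
      cases ε with
      | true =>
        refine ⟨1, fun h => one_notMem_branch k (h.2 ?_)⟩
        simp [branch, startsWith, hg]
      | false =>
        -- Here g starts with i⁻¹, which u = i cancels; as g is reduced, what remains does not start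
        -- with i.
        refine ⟨of k, fun h => ?_⟩
        have h1 := h.1 (of_mem_branch k)
        have h2 : of k * g = mk L := by
          rw [hgs, show mk [(k, false)] = (of k)⁻¹ from rfl, mul_inv_cancel_left]
        rw [h2, branch, startsWith, Set.mem_ofPred_eq, hL] at h1
        have h3 := isReduced_toWord (x := g)
        rw [hg] at h3
        rcases L with _ | ⟨t, L⟩
        · simp at h1
        · simp at h1
          subst h1
          simp [IsReduced] at h3
    · have hkj : k = j := by omega
      subst hkj
      rcases ih _ hL with h | ⟨u, hu⟩
      · left
        rw [hgs]
        refine mul_mem ?_ h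
        cases ε with
        | true => exact Subgroup.mem_zpowers _
        | false => exact inv_mem (Subgroup.mem_zpowers (of k))
      · right
        -- The first letter is j or j⁻¹. It is compensated at the end of u, which does not affect
        -- membership in the branch of i.
        cases ε with
        | true =>
          refine ⟨u * (of k)⁻¹, ?_⟩
          have : u * (of k)⁻¹ * g = u * mk L := by rw [hgs, of]; group
          rwa [this, mul_of_inv_mem_branch_of_ne hij]
        | false =>
          refine ⟨u * of k, ?_⟩
          have : u * of k * g = u * mk L := by
            rw [hgs, show mk [(k, false)] = (of k)⁻¹ from rfl]; group
          rwa [this, mul_of_mem_branch_of_ne hij]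

end startsWith

end FreeGroup

/-! ### Sliding edges along lines -/

section
open FreeGroup

/-- A measurable shift-equivariant way to choose a permutation of `ℤ` for each labelling
of `ℤ` by elements of `W`. -/
structure LinePerm (W : Type*) [MeasurableSpace W] where
  /-- The permutation chosen for a labelling. -/
  perm : (ℤ → W) → Equiv.Perm ℤ
  perm_shift : ∀ w t k, perm (fun m => w (m + t)) k = perm w (k + t) - t
  measurable_perm : ∀ k, Measurable fun w => perm w k

namespace LinePerm
variable {W : Type*} [MeasurableSpace W] (π : LinePerm W)

theorem perm_shift_symm (w : ℤ → W) (t k : ℤ) :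
    (π.perm fun m => w (m + t)).symm k = (π.perm w).symm (k + t) - t := by
  rw [Equiv.symm_apply_eq, π.perm_shift]
  simp

/-- The inverse permutations. -/
def symm : LinePerm W where
  perm w := (π.perm w).symm
  perm_shift := π.perm_shift_symm
  measurable_perm k := by
    refine measurable_to_countable' fun l => ?_
    have : (fun w => (π.perm w).symm k) ⁻¹' {l} = (fun w => π.perm w l) ⁻¹' {k} := by
      ext w
      simp only [Set.mem_preimage, Set.mem_singleton_iff, Equiv.symm_apply_eq]
      exact eq_comm
    rw [this]
    exact π.measurable_perm l (measurableSet_singleton k)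

@[simp] theorem symm_perm (w : ℤ → W) : π.symm.perm w = (π.perm w).symm := rfl

@[simp] theorem symm_symm : π.symm.symm = π := rfl

end LinePerm

section lineAt
variable {α W : Type*}

/-- The labels of `x` along the line through `g` in the direction of the letter `j`. -/
def lineAt (j : α) (x : FreeGroup α → W) (g : FreeGroup α) : ℤ → W :=
  fun m => x (g * of j ^ m)

theorem lineAt_mul_zpow (j : α) (x : FreeGroup α → W) (g : FreeGroup α) (t : ℤ) :
    lineAt j x (g * of j ^ t) = fun m => lineAt j x g (m + t) := by
  ext m
  rw [lineAt, lineAt, mul_assoc, ← zpow_add, add_comm]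

theorem lineAt_translate (j : α) (x : FreeGroup α → W) (g h : FreeGroup α) :
    lineAt j (fun u => x (g * u)) h = lineAt j x (g * h) := by
  ext m
  simp [lineAt, mul_assoc]

theorem measurable_lineAt [MeasurableSpace W] (j : α) (g : FreeGroup α) :
    Measurable fun x : FreeGroup α → W => lineAt j x g := by
  unfold lineAt; fun_prop

end lineAt

namespace LinePerm
variable {α W : Type*} [MeasurableSpace W] (i j : α) (π : LinePerm W)

/-- The slid edge with letter `i` starting at `g`: first move along the `j`-line of `g` as `π`
prescribes, then along the letter `i`. -/
def slideEdge (x : FreeGroup α → W) : Equiv.Perm (FreeGroup α) where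
  toFun g := g * of j ^ (π.perm (lineAt j x g) 0) * of i
  invFun g := g * (of i)⁻¹ * of j ^ ((π.perm (lineAt j x (g * (of i)⁻¹))).symm 0)
  -- By equivariance, the permutation read from another origin on the line is the same one up to
  -- relabelling, so the return move is its inverse.
  left_inv g := by
    simp only [mul_inv_cancel_right, lineAt_mul_zpow, perm_shift_symm]
    simp
  right_inv g := by
    simp only [lineAt_mul_zpow, perm_shift]
    simp

theorem slideEdge_apply (x : FreeGroup α → W) (g : FreeGroup α) :
    π.slideEdge i j x g = g * of j ^ (π.perm (lineAt j x g) 0) * of i := rfl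

theorem slideEdge_symm_apply (x : FreeGroup α → W) (g : FreeGroup α) : (π.slideEdge i j x).symm g =
    g * (of i)⁻¹ * of j ^ ((π.perm (lineAt j x (g * (of i)⁻¹))).symm 0) := rfl

theorem measurableSet_slideEdge_eq (g h : FreeGroup α) :
    MeasurableSet {x : FreeGroup α → W | π.slideEdge i j x g = h} := by
  have : Measurable fun x : FreeGroup α → W => π.perm (lineAt j x g) 0 :=
    (π.measurable_perm 0).comp (measurable_lineAt j g)
  exact this (MeasurableSet.of_discrete (s := {m : ℤ | g * of j ^ m * of i = h}))

variable [DecidableEq α]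

/-- The right translations by letters, with the letter `i` slid. -/
def slideStep (x : FreeGroup α → W) (k : α) : Equiv.Perm (FreeGroup α) :=
  if k = i then π.slideEdge i j x else Equiv.mulRight (of k)

/-- The position reached from `1` by the word `h`, when the edges with letter `i` are slid. -/
def pos (x : FreeGroup α → W) (h : FreeGroup α) : FreeGroup α :=
  walk (π.slideStep i j x) 1 h

/-- The labelling `x` seen from the slid edges. -/
def slide (x : FreeGroup α → W) (h : FreeGroup α) : W := x (π.pos i j x h)

variable (x : FreeGroup α → W)

@[simp] theorem pos_one : π.pos i j x 1 = 1 := by simp [pos]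

theorem pos_mul_of (h : FreeGroup α) :
    π.pos i j x (h * of i) = π.slideEdge i j x (π.pos i j x h) := by
  simp [pos, walk_mul_of, slideStep]

theorem pos_mul_of_inv (h : FreeGroup α) :
    π.pos i j x (h * (of i)⁻¹) = (π.slideEdge i j x).symm (π.pos i j x h) := by
  simp [pos, walk_mul_of_inv, slideStep]

variable {i j}

theorem pos_mul_of_ne {k : α} (hk : k ≠ i) (h : FreeGroup α) :
    π.pos i j x (h * of k) = π.pos i j x h * of k := by
  simp [pos, walk_mul_of, slideStep, hk]

theorem pos_mul_of_inv_ne {k : α} (hk : k ≠ i) (h : FreeGroup α) :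
    π.pos i j x (h * (of k)⁻¹) = π.pos i j x h * (of k)⁻¹ := by
  simp [pos, walk_mul_of_inv, slideStep, hk]

theorem pos_mul_zpow_ne {k : α} (hk : k ≠ i) (h : FreeGroup α) (m : ℤ) :
    π.pos i j x (h * of k ^ m) = π.pos i j x h * of k ^ m := by
  induction m using Int.induction_on with
  | zero => simp
  | succ m ih => rw [zpow_add_one, ← mul_assoc, pos_mul_of_ne π x hk, ih, mul_assoc]
  | pred m ih => rw [zpow_sub_one, ← mul_assoc, pos_mul_of_inv_ne π x hk, ih, mul_assoc]

/-- Only i-edges are slid, so j-lines keep their labels. Hence `π` sees the same lines before and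
after sliding, which makes the slide reversible. -/
theorem lineAt_slide (hij : j ≠ i) (h : FreeGroup α) :
    lineAt j (π.slide i j x) h = lineAt j x (π.pos i j x h) := by
  ext m
  rw [lineAt, lineAt, slide, pos_mul_zpow_ne π x hij]

theorem pos_slideEdge_symm (hij : j ≠ i) (h : FreeGroup α) :
    π.pos i j x (π.symm.slideEdge i j (π.slide i j x) h) = π.pos i j x h * of i := by
  rw [slideEdge_apply, pos_mul_of, pos_mul_zpow_ne π x hij, lineAt_slide π x hij, slideEdge_apply,
    lineAt_mul_zpow, perm_shift]
  simp

/-- Sliding the new edges back by `π.symm` restores the old edges. This gives surjectivity of `pos`;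
`pos_symm_pos` gives injectivity. -/
theorem pos_pos_symm (hij : j ≠ i) (g : FreeGroup α) :
    π.pos i j x (π.symm.pos i j (π.slide i j x) g) = g := by
  induction g using induction_right with
  | one => simp
  | mul_of g k ih =>
    by_cases hk : k = i
    · subst hk; rw [pos_mul_of, pos_slideEdge_symm π x hij, ih]
    · rw [pos_mul_of_ne _ _ hk, pos_mul_of_ne _ _ hk, ih]
  | mul_of_inv g k ih =>
    by_cases hk : k = i
    · subst hk
      rw [pos_mul_of_inv, eq_mul_inv_iff_mul_eq, ← pos_slideEdge_symm π x hij,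
        Equiv.apply_symm_apply, ih]
    · rw [pos_mul_of_inv_ne _ _ hk, pos_mul_of_inv_ne _ _ hk, ih]

theorem slide_symm_slide (hij : j ≠ i) : π.symm.slide i j (π.slide i j x) = x := by
  ext g
  rw [slide, slide, pos_pos_symm π x hij]

theorem pos_symm_pos (hij : j ≠ i) (g : FreeGroup α) :
    π.symm.pos i j (π.slide i j x) (π.pos i j x g) = g := by
  have h := π.symm.pos_pos_symm (π.slide i j x) hij g
  rwa [slide_symm_slide π x hij, symm_symm] at h

/-- The slid edges are chosen equivariantly, so the walk continued from `pos k` is the walk from 1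
for the labelling recentred there. This is the cocycle identity of an orbit equivalence. -/
theorem pos_mul (h k : FreeGroup α) : π.pos i j x (k * h) =
    π.pos i j x k * π.pos i j (fun u => x (π.pos i j x k * u)) h := by
  induction h using induction_right with
  | one => simp
  | mul_of h l ih =>
    rw [← mul_assoc]
    by_cases hl : l = i
    · subst hl
      rw [pos_mul_of, pos_mul_of, ih, slideEdge_apply, slideEdge_apply, lineAt_translate]
      simp only [mul_assoc]
    · rw [pos_mul_of_ne _ _ hl, pos_mul_of_ne _ _ hl, ih, mul_assoc]
  | mul_of_inv h l ih =>
    rw [← mul_assoc]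
    by_cases hl : l = i
    · subst hl
      rw [pos_mul_of_inv, pos_mul_of_inv, ih, slideEdge_symm_apply, slideEdge_symm_apply,
        lineAt_translate]
      simp only [mul_assoc]
    · rw [pos_mul_of_inv_ne _ _ hl, pos_mul_of_inv_ne _ _ hl, ih, mul_assoc]

/-- This makes sliding an orbit equivalence: since `pos` is onto for j ≠ i, every translate of x
corresponds to a translate of the slid labelling. -/
theorem slide_translate (k : FreeGroup α) :
    π.slide i j (fun u => x (π.pos i j x k * u)) = fun h => π.slide i j x (k * h) := by
  ext h
  rw [slide, slide, pos_mul]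

theorem measurableSet_pos_eq [Countable α] (h g : FreeGroup α) :
    MeasurableSet {x : FreeGroup α → W | π.pos i j x h = g} := by
  induction h using induction_right generalizing g with
  | one => simp
  | mul_of h k ih =>
    by_cases hk : k = i
    · subst hk
      have : {x : FreeGroup α → W | π.pos k j x (h * of k) = g} =
          ⋃ g', {x | π.pos k j x h = g'} ∩ {x | π.slideEdge k j x g' = g} := by
        ext x; simp [pos_mul_of]
      rw [this]
      exact .iUnion fun g' => (ih g').inter (π.measurableSet_slideEdge_eq _ _ _ _)
    · simp only [pos_mul_of_ne _ _ hk, ← eq_mul_inv_iff_mul_eq]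
      exact ih _
  | mul_of_inv h k ih =>
    by_cases hk : k = i
    · subst hk
      have : {x : FreeGroup α → W | π.pos k j x (h * (of k)⁻¹) = g} =
          ⋃ g', {x | π.pos k j x h = g'} ∩ {x | π.slideEdge k j x g = g'} := by
        ext x
        simp only [Set.mem_ofPred_eq, pos_mul_of_inv, Set.mem_iUnion, Set.mem_inter_iff,
          exists_eq_left', Equiv.symm_apply_eq]
        exact eq_comm
      rw [this]
      exact .iUnion fun g' => (ih g').inter (π.measurableSet_slideEdge_eq _ _ _ _)
    · simp only [pos_mul_of_inv_ne _ _ hk, mul_inv_eq_iff_eq_mul]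
      exact ih _

theorem measurable_slide [Countable α] :
    Measurable fun x : FreeGroup α → W => π.slide i j x := by
  refine measurable_pi_lambda _ fun h E hE => ?_
  have : (fun x : FreeGroup α → W => π.slide i j x h) ⁻¹' E =
      ⋃ g, {x | π.pos i j x h = g} ∩ {x | x g ∈ E} := by
    ext x; simp [slide]
  rw [this]
  exact .iUnion fun g => (π.measurableSet_pos_eq h g).inter (measurable_pi_apply g hE)

/-- Sliding, as an isomorphism of measurable spaces. -/
def slideEquiv [Countable α] (hij : j ≠ i) : (FreeGroup α → W) ≃ᵐ (FreeGroup α → W) where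
  toFun := π.slide i j
  invFun := π.symm.slide i j
  left_inv x := slide_symm_slide π x hij
  right_inv x := by simpa using slide_symm_slide π.symm x hij
  measurable_toFun := π.measurable_slide
  measurable_invFun := π.symm.measurable_slide

end LinePerm

end

/-! ### Sliding preserves the Bernoulli measure -/

section
open FreeGroup

theorem FreeGroup.of_zpow_injective {α : Type*} (j : α) :
    Function.Injective fun m : ℤ => (of j) ^ m := by
  intro m n h
  have := congrArg (lift fun _ => Multiplicative.ofAdd (1 : ℤ)) h
  simp only [map_zpow, lift_apply_of, ← ofAdd_zsmul] at this
  simpa using this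

/-- Under a product measure, events that depend on disjoint sets of coordinates are
independent. -/
theorem infinitePi_inter_of_dependsOn {ι W : Type*} [MeasurableSpace W] (ω : Measure W)
    [IsProbabilityMeasure ω] (H : Set ι) {E F : Set (ι → W)} (hE : MeasurableSet E)
    (hF : MeasurableSet F) (hEH : ∀ x z : ι → W, (∀ g ∈ H, x g = z g) → x ∈ E → z ∈ E)
    (hFH : ∀ x z : ι → W, (∀ g ∉ H, x g = z g) → x ∈ F → z ∈ F) :
    Measure.infinitePi (fun _ : ι => ω) (E ∩ F) =
      Measure.infinitePi (fun _ : ι => ω) E * Measure.infinitePi (fun _ : ι => ω) F := by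
  classical
  obtain ⟨w⟩ : Nonempty W := nonempty_of_isProbabilityMeasure ω
  have hind := (iIndepFun_infinitePi (P := fun _ : ι => ω) (X := fun _ (x : W) => x)
    (fun _ => measurable_id)).iIndep
  have hle : ∀ g : ι, MeasurableSpace.comap (fun x : ι → W => x g) inferInstance ≤
      MeasurableSpace.pi := fun g => (measurable_pi_apply g).comap_le
  have key : ∀ (S : Set ι) (E : Set (ι → W)), MeasurableSet E →
      (∀ x z : ι → W, (∀ g ∈ S, x g = z g) → x ∈ E → z ∈ E) →
      MeasurableSet[⨆ g ∈ S, MeasurableSpace.comap (fun x : ι → W => x g) inferInstance] E := by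
    intro S E hE hES
    have hm : Measurable[⨆ g ∈ S, MeasurableSpace.comap (fun x : ι → W => x g) inferInstance]
        (fun (x : ι → W) (g : ι) => if g ∈ S then x g else w) := by
      refine @measurable_pi_lambda _ _ _ (⨆ g ∈ S, MeasurableSpace.comap _ inferInstance) _ _
        fun g => ?_
      by_cases hg : g ∈ S
      · simp only [hg, if_true]
        exact (comap_measurable fun x : ι → W => x g).mono
          (le_iSup₂_of_le (f := fun g (_ : g ∈ S) => MeasurableSpace.comap
            (fun x : ι → W => x g) inferInstance) g hg le_rfl) le_rfl
      · simp only [hg, if_false]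
        exact measurable_const
    -- Freezing the coordinates outside S at `w` gives a map measurable for the σ-algebra of S, and
    -- E is its own preimage because it depends on S only.
    have : (fun (x : ι → W) (g : ι) => if g ∈ S then x g else w) ⁻¹' E = E := by
      ext x
      exact ⟨hES _ _ fun g hg => by simp [hg], hES _ _ fun g hg => by simp [hg]⟩
    rw [← this]
    exact hm hE
  exact (Indep_iff _ _ _).1 (indep_iSup_of_disjoint hle hind (S := H) (T := Hᶜ)
    disjoint_compl_right) E F (key H E hE hEH) (key Hᶜ F hF hFH)

theorem map_translate_infinitePi {α W : Type*} [MeasurableSpace W] (ω : Measure W)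
    [IsProbabilityMeasure ω] (g : FreeGroup α) :
    (Measure.infinitePi fun _ : FreeGroup α => ω).map (fun x h => x (g * h)) =
      Measure.infinitePi fun _ : FreeGroup α => ω :=
  (measurePreserving_reindex ω (Equiv.mulLeft g)).map_eq

/-- A translation-invariant measure on labellings of the free group of rank two, for which the
labels along one `j`-line are i.i.d., and the labels on a branch of `i` are independent of
the other labels, is the product measure. -/
theorem eq_infinitePi_of_splits {W : Type*} [MeasurableSpace W] (ω : Measure W)
    [IsProbabilityMeasure ω] {i j : Fin 2} (hij : j ≠ i)
    (P : Measure (FreeGroup (Fin 2) → W))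
    (htrans : ∀ k : FreeGroup (Fin 2), P.map (fun x h => x (k * h)) = P)
    (hline : P.map (fun x => lineAt j x 1) = Measure.infinitePi fun _ : ℤ => ω)
    (hsplit : ∀ (s : Finset (FreeGroup (Fin 2))) (t : FreeGroup (Fin 2) → Set W),
      (∀ g, MeasurableSet (t g)) →
      P (Set.pi s t) = P (Set.pi (s ∩ branch i) t) * P (Set.pi (s \ branch i) t)) :
    P = Measure.infinitePi fun _ => ω := by
  classical
  have hmove : ∀ (k : FreeGroup (Fin 2)) (s : Finset (FreeGroup (Fin 2)))
      (t : FreeGroup (Fin 2) → Set W), (∀ g, MeasurableSet (t g)) →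
      P (Set.pi s t) = P (Set.pi (s.map (Equiv.mulLeft k).toEmbedding) fun g => t (k⁻¹ * g)) := by
    intro k s t ht
    conv_rhs => rw [← htrans k⁻¹]
    rw [Measure.map_apply (by fun_prop) (.pi (Finset.countable_toSet _) fun _ _ => ht _)]
    congr 1
    ext x
    simp only [Set.mem_pi, Set.mem_preimage, Finset.mem_coe, Finset.mem_map_equiv]
    exact ⟨fun h g hg => h (k⁻¹ * g) hg, fun h g hg => by
      have := h (k * g) (by simpa using hg)
      rwa [inv_mul_cancel_left] at this⟩
  refine Measure.eq_infinitePi _ fun s t ht => ?_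
  induction hn : s.card using Nat.strong_induction_on generalizing s t with
  | _ n ih =>
  -- A set within one j-line is settled by `hline`. Otherwise the branch cuts a translate of s into
  -- two smaller nonempty pieces, to which induction on the cardinality applies.
  by_cases hs : ∀ p ∈ s, ∀ q ∈ s, p⁻¹ * q ∈ Subgroup.zpowers (of j)
  · rcases s.eq_empty_or_nonempty with rfl | ⟨p, hp⟩
    · have : P Set.univ = 1 := by
        have h := congrArg (fun m => m Set.univ) hline
        simp only [measure_univ] at h
        rwa [Measure.map_apply (measurable_lineAt j 1) .univ, Set.preimage_univ] at h
      simpa using this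
    have hinj : Function.Injective fun m : ℤ => p * of j ^ m :=
      (mul_right_injective p).comp (of_zpow_injective j)
    have hp1 : P.map (fun x => lineAt j x p) = Measure.infinitePi fun _ : ℤ => ω := by
      rw [← hline]
      conv_rhs => rw [← htrans p]
      rw [Measure.map_map (measurable_lineAt j 1) (by fun_prop)]
      congr 1
      ext x m
      simp [lineAt]
    have h1 : Set.pi (s : Set (FreeGroup (Fin 2))) t = (fun x => lineAt j x p) ⁻¹'
        (Set.pi (s.preimage (fun m : ℤ => p * of j ^ m) hinj.injOn : Finset ℤ)
          fun m => t (p * of j ^ m)) := by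
      ext x
      simp only [Set.mem_pi, Finset.mem_coe, Set.mem_preimage, Finset.mem_preimage, lineAt]
      refine ⟨fun h m hm => h _ hm, fun h g hg => ?_⟩
      obtain ⟨m, hm⟩ := hs p hp g hg
      have hg' : g = p * of j ^ m := by simp only at hm; rw [hm]; group
      rw [hg'] at hg ⊢
      exact h m hg
    rw [h1, ← Measure.map_apply (measurable_lineAt j p)
      (.pi (Finset.countable_toSet _) fun _ _ => ht _), hp1,
      Measure.infinitePi_pi _ fun m _ => ht _]
    refine Finset.prod_preimage _ s _ (fun g => ω (t g)) fun g hg hgr => absurd ?_ hgr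
    obtain ⟨m, hm⟩ := hs p hp g hg
    refine ⟨m, ?_⟩
    simp only at hm ⊢
    rw [hm]; group
  · push Not at hs
    obtain ⟨p, hp, q, hq, hpq⟩ := hs
    obtain ⟨u, hu⟩ := (exists_separating_branch hij (p⁻¹ * q)).resolve_left hpq
    set k := u * p⁻¹ with hk
    set s' := s.map (Equiv.mulLeft k).toEmbedding with hs'
    have hcard : s'.card = n := by rw [hs', Finset.card_map, hn]
    have hup : u ∈ s' := Finset.mem_map.2 ⟨p, hp, by simp [hk]⟩
    have huq : u * (p⁻¹ * q) ∈ s' := Finset.mem_map.2 ⟨q, hq, by simp [hk]⟩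
    have hfil := Finset.card_filter_add_card_filter_not (s := s') (· ∈ branch i)
    have hpos : 0 < (s'.filter (· ∈ branch i)).card ∧ 0 < (s'.filter (· ∉ branch i)).card := by
      simp only [Finset.card_pos]
      by_cases h : u ∈ branch i
      · have h' : u * (p⁻¹ * q) ∉ branch i := fun h' => hu (iff_of_true h h')
        exact ⟨⟨u, by simp [hup, h]⟩, ⟨_, Finset.mem_filter.2 ⟨huq, h'⟩⟩⟩
      · have h' : u * (p⁻¹ * q) ∈ branch i := by
          by_contra h'; exact hu (iff_of_false h h')
        exact ⟨⟨_, Finset.mem_filter.2 ⟨huq, h'⟩⟩, ⟨u, by simp [hup, h]⟩⟩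
    have ht' : ∀ g, MeasurableSet (t (k⁻¹ * g)) := fun g => ht _
    have h1 := ih _ (by omega) (s'.filter (· ∈ branch i)) (fun g => t (k⁻¹ * g)) ht' rfl
    have h2 := ih _ (by omega) (s'.filter (· ∉ branch i)) (fun g => t (k⁻¹ * g)) ht' rfl
    have e1 : ((s'.filter (· ∈ branch i) : Finset _) : Set (FreeGroup (Fin 2))) =
        ↑s' ∩ branch i := by ext; simp
    have e2 : ((s'.filter (· ∉ branch i) : Finset _) : Set (FreeGroup (Fin 2))) =
        ↑s' \ branch i := by ext; simp
    rw [hmove k s t ht, hsplit _ _ ht', ← hs', ← e1, ← e2, h1, h2,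
      Finset.prod_filter_mul_prod_filter_not, hs', Finset.prod_map]
    simp

theorem lineAt_congr {α W : Type*} {j : α} {x z : FreeGroup α → W} {S : Set (FreeGroup α)} (hS : ∀ g (m : ℤ), g ∈ S → g * of j ^ m ∈ S)
    (hxz : ∀ g ∈ S, x g = z g) {g : FreeGroup α} (hg : g ∈ S) : lineAt j x g = lineAt j z g :=
  funext fun m => hxz _ (hS g m hg)

namespace LinePerm
variable {W : Type*} [MeasurableSpace W] (π : LinePerm W) (ω : Measure W) [IsProbabilityMeasure ω]

section recenter
variable {α : Type*} (j : α)

/-- Move the origin along its `j`-line as `π` prescribes. -/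
def recenter (x : FreeGroup α → W) : FreeGroup α → W :=
  fun h => x (of j ^ (π.perm (lineAt j x 1) 0) * h)

theorem measurable_perm_lineAt (g : FreeGroup α) (k : ℤ) :
    Measurable fun x : FreeGroup α → W => π.perm (lineAt j x g) k :=
  (π.measurable_perm k).comp (measurable_lineAt j g)

theorem preimage_recenter (E : Set (FreeGroup α → W)) : π.recenter j ⁻¹' E =
    ⋃ m : ℤ, {x | π.perm (lineAt j x 1) 0 = m} ∩ (fun x h => x (of j ^ m * h)) ⁻¹' E := by
  ext x
  simp only [Set.mem_preimage, Set.mem_iUnion, Set.mem_inter_iff, Set.mem_ofPred_eq,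
    exists_eq_left']
  rfl

/-- On the piece where `π` sends 0 to m the map is a translation, and the images of the pieces are
the sets where `π.symm` sends 0 to -m, which again form a partition. -/
theorem measurePreserving_recenter :
    MeasurePreserving (π.recenter j) (Measure.infinitePi fun _ : FreeGroup α => ω)
      (Measure.infinitePi fun _ : FreeGroup α => ω) := by
  have hM : ∀ (π : LinePerm W) (m : ℤ),
      MeasurableSet {x : FreeGroup α → W | π.perm (lineAt j x 1) 0 = m} := fun π m =>
    π.measurable_perm_lineAt j 1 0 (measurableSet_singleton m)
  have hT : ∀ g : FreeGroup α, Measurable fun (x : FreeGroup α → W) h => x (g * h) := by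
    intro g; fun_prop
  have hmeas : Measurable (π.recenter j) := by
    intro E hE
    rw [preimage_recenter]
    exact .iUnion fun m => (hM π m).inter (hT _ hE)
  refine ⟨hmeas, Measure.ext fun E hE => ?_⟩
  rw [Measure.map_apply hmeas hE, preimage_recenter, measure_iUnion ?_
    fun m => (hM π m).inter (hT _ hE)]
  · have h1 : ∀ m : ℤ, {x : FreeGroup α → W | π.perm (lineAt j x 1) 0 = m} ∩
        (fun x h => x (of j ^ m * h)) ⁻¹' E = (fun x h => x (of j ^ m * h)) ⁻¹'
          ({x | π.symm.perm (lineAt j x 1) 0 = -m} ∩ E) := by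
      intro m
      ext x
      simp only [Set.mem_inter_iff, Set.mem_ofPred_eq, Set.mem_preimage, lineAt_translate,
        symm_perm, and_congr_left_iff]
      intro _
      have := lineAt_mul_zpow j x 1 m
      rw [one_mul] at this
      rw [mul_one, this, perm_shift_symm, sub_eq_neg_self, zero_add, Equiv.symm_apply_eq]
      exact eq_comm
    have h2 : ∀ m : ℤ, Measure.infinitePi (fun _ : FreeGroup α => ω)
        ({x : FreeGroup α → W | π.perm (lineAt j x 1) 0 = m} ∩
          (fun x h => x (of j ^ m * h)) ⁻¹' E) =
        Measure.infinitePi (fun _ : FreeGroup α => ω)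
          ({x | π.symm.perm (lineAt j x 1) 0 = -m} ∩ E) := by
      intro m
      rw [h1, ← Measure.map_apply (hT _) ((hM _ _).inter hE), map_translate_infinitePi]
    simp_rw [h2]
    rw [← measure_iUnion ?_ fun m => (hM _ _).inter hE]
    · congr 1
      ext x
      simp only [Set.mem_iUnion, Set.mem_inter_iff, Set.mem_ofPred_eq, exists_and_right,
        and_iff_right_iff_imp]
      exact fun _ => ⟨-_, (neg_neg _).symm⟩
    · intro m n hmn
      refine Set.disjoint_left.2 fun x hx hx' => hmn ?_
      have := hx.1.symm.trans hx'.1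
      simpa using this
  · intro m n hmn
    exact Set.disjoint_left.2 fun x hx hx' => hmn (hx.1.symm.trans hx'.1)

end recenter

section branch
variable {α : Type*} {i j : α} (x z : FreeGroup α → W)

/-- The position on the `j`-line of `1` from which the slid edge with letter `i` ends at the letter
`i`. -/
def base (j : α) (x : FreeGroup α → W) : FreeGroup α := of j ^ ((π.perm (lineAt j x 1)).symm 0)

/-- Seen from `base`, sliding carries the edge that enters the branch to one that enters it at the
same vertex `of i`. This is the reason for moving the starting point there. -/
theorem slideEdge_base : π.slideEdge i j x (π.base j x) = of i := by
  have := lineAt_mul_zpow j x 1 ((π.perm (lineAt j x 1)).symm 0)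
  rw [one_mul] at this
  rw [slideEdge_apply, base, this, perm_shift]
  simp

theorem slideEdge_translate (k g : FreeGroup α) :
    k * π.slideEdge i j (fun u => x (k * u)) g = π.slideEdge i j x (k * g) := by
  rw [slideEdge_apply, slideEdge_apply, lineAt_translate]
  simp only [mul_assoc]

variable [DecidableEq α]

/-- The position reached from the base point by the word `h` when the edges with letter `i`
are slid. -/
def posBase (i j : α) (x : FreeGroup α → W) (h : FreeGroup α) : FreeGroup α :=
  π.base j x * π.pos i j (fun u => x (π.base j x * u)) h

theorem posBase_injective (hij : j ≠ i) : Function.Injective (π.posBase i j x) :=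
  (mul_right_injective _).comp
    (Function.LeftInverse.injective (pos_symm_pos π _ hij))

theorem posBase_one : π.posBase i j x 1 = π.base j x := by simp [posBase]

theorem posBase_mul_of (h : FreeGroup α) :
    π.posBase i j x (h * of i) = π.slideEdge i j x (π.posBase i j x h) := by
  rw [posBase, pos_mul_of, slideEdge_translate]
  rfl

theorem posBase_mul_of_inv (h : FreeGroup α) :
    π.posBase i j x (h * (of i)⁻¹) = (π.slideEdge i j x).symm (π.posBase i j x h) := by
  rw [Equiv.eq_symm_apply, ← posBase_mul_of, inv_mul_cancel_right]

theorem posBase_mul_of_ne {k : α} (hk : k ≠ i) (h : FreeGroup α) :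
    π.posBase i j x (h * of k) = π.posBase i j x h * of k := by
  rw [posBase, pos_mul_of_ne _ _ hk, ← mul_assoc]; rfl

theorem posBase_mul_of_inv_ne {k : α} (hk : k ≠ i) (h : FreeGroup α) :
    π.posBase i j x (h * (of k)⁻¹) = π.posBase i j x h * (of k)⁻¹ := by
  rw [posBase, pos_mul_of_inv_ne _ _ hk, ← mul_assoc]; rfl

variable {x z}

/-- The walk from `base` can enter the branch only over the slid edge ending at `of i`, which by
injectivity is the image of the edge leaving 1. Words outside the branch avoid that edge, so their
walks stay outside and consult only labels there. -/
theorem posBase_congr_compl_branch (hij : j ≠ i) (hxz : ∀ g ∉ branch i, x g = z g)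
    (h : FreeGroup α) : h ∉ branch i →
      π.posBase i j x h = π.posBase i j z h ∧ π.posBase i j x h ∉ branch i := by
  have hline : ∀ g ∉ branch i, lineAt j x g = lineAt j z g := fun g hg =>
    lineAt_congr (S := (branch i)ᶜ)
      (fun g m hg => (mul_zpow_mem_branch_of_ne hij g m).not.2 hg) hxz hg
  have hone : π.posBase i j x 1 = π.posBase i j z 1 ∧ π.posBase i j x 1 ∉ branch i := by
    rw [posBase_one, posBase_one, base, base, hline 1 (one_notMem_branch i)]
    refine ⟨rfl, ?_⟩
    rw [← one_mul (of j ^ _), mul_zpow_mem_branch_of_ne hij]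
    exact one_notMem_branch i
  induction h using induction_right with
  | one => exact fun _ => hone
  | mul_of h k ih =>
    intro hh
    by_cases hk : k = i
    · subst hk
      have h1 : h ≠ 1 := by rintro rfl; exact hh (by rw [one_mul]; exact of_mem_branch _)
      obtain ⟨e, he⟩ := ih ((mul_of_mem_branch h1).not.1 hh)
      rw [posBase_mul_of, posBase_mul_of, ← e]
      refine ⟨by rw [slideEdge_apply, slideEdge_apply, hline _ he], ?_⟩
      rw [slideEdge_apply, mul_of_mem_branch, mul_zpow_mem_branch_of_ne hij]
      · exact he
      intro hc
      refine h1 (π.posBase_injective x hij ((π.slideEdge k j x).injective ?_))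
      rw [slideEdge_apply, hc, posBase_one, slideEdge_base, one_mul]
    · rw [posBase_mul_of_ne _ _ hk, posBase_mul_of_ne _ _ hk, mul_of_mem_branch_of_ne hk]
      obtain ⟨e, he⟩ := ih ((mul_of_mem_branch_of_ne hk h).not.1 hh)
      exact ⟨by rw [e], he⟩
  | mul_of_inv h k ih =>
    intro hh
    by_cases hk : k = i
    · subst hk
      by_cases h1 : h = of k
      · rw [h1, mul_inv_cancel]; exact hone
      obtain ⟨e, he⟩ := ih ((mul_of_inv_mem_branch h1).not.1 hh)
      have hn : π.posBase k j x h ≠ of k := fun hc => he (hc ▸ of_mem_branch k)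
      have he' := (mul_of_inv_mem_branch hn).not.2 he
      rw [posBase_mul_of_inv, posBase_mul_of_inv, ← e, slideEdge_symm_apply,
        slideEdge_symm_apply, hline _ he', mul_zpow_mem_branch_of_ne hij]
      exact ⟨rfl, he'⟩
    · rw [posBase_mul_of_inv_ne _ _ hk, posBase_mul_of_inv_ne _ _ hk,
        mul_of_inv_mem_branch_of_ne hk]
      obtain ⟨e, he⟩ := ih ((mul_of_inv_mem_branch_of_ne hk h).not.1 hh)
      exact ⟨by rw [e], he⟩

/-- The first step always leads to `of i`, whatever the labels on the j-line of 1 are; from there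
the walk never leaves the branch. -/
theorem posBase_congr_branch (hij : j ≠ i) (hxz : ∀ g ∈ branch i, x g = z g)
    (h : FreeGroup α) : h ∈ branch i →
      π.posBase i j x h = π.posBase i j z h ∧ π.posBase i j x h ∈ branch i := by
  have hline : ∀ g ∈ branch i, lineAt j x g = lineAt j z g := fun g hg =>
    lineAt_congr (fun g m hg => (mul_zpow_mem_branch_of_ne hij g m).2 hg) hxz hg
  induction h using induction_right with
  | one => exact fun h => absurd h (one_notMem_branch i)
  | mul_of h k ih =>
    intro hh
    by_cases hk : k = i
    · subst hk
      by_cases h1 : h = 1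
      · subst h1
        rw [posBase_mul_of, posBase_mul_of, posBase_one, posBase_one, slideEdge_base,
          slideEdge_base]
        exact ⟨rfl, of_mem_branch k⟩
      obtain ⟨e, he⟩ := ih ((mul_of_mem_branch h1).1 hh)
      rw [posBase_mul_of, posBase_mul_of, ← e]
      refine ⟨by rw [slideEdge_apply, slideEdge_apply, hline _ he], ?_⟩
      have hb := (mul_zpow_mem_branch_of_ne hij _
        (π.perm (lineAt j x (π.posBase k j x h)) 0)).2 he
      rw [slideEdge_apply, mul_of_mem_branch]
      · exact hb
      · exact fun hc => one_notMem_branch k (hc ▸ hb)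
    · rw [posBase_mul_of_ne _ _ hk, posBase_mul_of_ne _ _ hk, mul_of_mem_branch_of_ne hk]
      obtain ⟨e, he⟩ := ih ((mul_of_mem_branch_of_ne hk h).1 hh)
      exact ⟨by rw [e], he⟩
  | mul_of_inv h k ih =>
    intro hh
    by_cases hk : k = i
    · subst hk
      have h1 : h ≠ of k := by
        rintro rfl; rw [mul_inv_cancel] at hh; exact one_notMem_branch k hh
      obtain ⟨e, he⟩ := ih ((mul_of_inv_mem_branch h1).1 hh)
      have hn : π.posBase k j x h ≠ of k := by
        intro hc
        refine h1 (π.posBase_injective x hij ?_)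
        have := π.posBase_mul_of (i := k) (j := j) x 1
        rw [one_mul, posBase_one, slideEdge_base] at this
        rw [hc, this]
      have he' := (mul_of_inv_mem_branch hn).2 he
      rw [posBase_mul_of_inv, posBase_mul_of_inv, ← e, slideEdge_symm_apply,
        slideEdge_symm_apply, hline _ he', mul_zpow_mem_branch_of_ne hij]
      exact ⟨rfl, he'⟩
    · rw [posBase_mul_of_inv_ne _ _ hk, posBase_mul_of_inv_ne _ _ hk,
        mul_of_inv_mem_branch_of_ne hk]
      obtain ⟨e, he⟩ := ih ((mul_of_inv_mem_branch_of_ne hk h).1 hh)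
      exact ⟨by rw [e], he⟩

end branch

/-- Sliding preserves the Bernoulli measure. -/
theorem measurePreserving_slide {i j : Fin 2} (hij : j ≠ i) :
    MeasurePreserving (π.slide i j) (Measure.infinitePi fun _ => ω)
      (Measure.infinitePi fun _ => ω) := by
  refine ⟨π.measurable_slide, ?_⟩
  have hT : ∀ g : FreeGroup (Fin 2),
      Measurable fun (x : FreeGroup (Fin 2) → W) h => x (g * h) := by
    intro g; fun_prop
  set μ := Measure.infinitePi fun _ : FreeGroup (Fin 2) => ω with hμ
  set P := μ.map (π.slide i j) with hP
  -- Translating the slid labelling by a letter amounts to sliding a translate of x by a random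
  -- element; for the letter i that is recentring followed by an ordinary translation.
  have hgen : ∀ k : Fin 2, P.map (fun x h => x (of k * h)) = P := by
    intro k
    rw [hP, Measure.map_map (hT _) π.measurable_slide]
    have e : (fun (x : FreeGroup (Fin 2) → W) h => x (of k * h)) ∘ π.slide i j =
        π.slide i j ∘ fun x u => x (π.pos i j x (of k) * u) := by
      ext x h
      exact congrFun (slide_translate π x (of k)).symm h
    have hmp : MeasurePreserving (fun (x : FreeGroup (Fin 2) → W) u =>
        x (π.pos i j x (of k) * u)) μ μ := by
      by_cases hk : k = i
      · subst hk
        have : (fun (x : FreeGroup (Fin 2) → W) u => x (π.pos k j x (of k) * u)) =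
            (fun x u => x (of k * u)) ∘ π.recenter j := by
          ext x u
          have := π.pos_mul_of k j x 1
          rw [one_mul, pos_one, slideEdge_apply, one_mul] at this
          simp [recenter, this, mul_assoc]
        rw [this]
        exact (measurePreserving_reindex ω (Equiv.mulLeft (of k))).comp
          (π.measurePreserving_recenter ω j)
      · have : (fun (x : FreeGroup (Fin 2) → W) u => x (π.pos i j x (of k) * u)) =
            (fun x u => x (of k * u)) := by
          ext x u
          have := π.pos_mul_of_ne (j := j) x hk 1
          rw [one_mul, pos_one, one_mul] at this
          rw [this]
        rw [this]
        exact measurePreserving_reindex ω (Equiv.mulLeft (of k))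
    rw [e, ← Measure.map_map π.measurable_slide hmp.measurable, hmp.map_eq]
  have htrans : ∀ k : FreeGroup (Fin 2), P.map (fun x h => x (k * h)) = P := by
    have hcomp : ∀ g k : FreeGroup (Fin 2), P.map (fun x h => x (g * k * h)) =
        (P.map (fun x h => x (g * h))).map (fun x h => x (k * h)) := by
      intro g k
      rw [Measure.map_map (hT _) (hT _)]
      congr 1
      ext x h
      simp [mul_assoc]
    intro g
    induction g using induction_right with
    | one => simp
    | mul_of g k ih => rw [hcomp, ih, hgen]
    | mul_of_inv g k ih =>
      rw [hcomp, ih]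
      conv_lhs => rw [← hgen k]
      rw [← hcomp]
      simp
  refine eq_infinitePi_of_splits ω hij P htrans ?_ fun s t ht => ?_
  · rw [hP, Measure.map_map (measurable_lineAt j 1) π.measurable_slide]
    have : (fun x : FreeGroup (Fin 2) → W => lineAt j x 1) ∘ π.slide i j =
        fun x (m : ℤ) => x (of j ^ m) := by
      ext x m
      rw [Function.comp_apply, lineAt_slide π x hij, pos_one, lineAt, one_mul]
    rw [this]
    exact Measure.map_infinitePi_infinitePi_of_inj (of_zpow_injective j)
  · have hP' : P = μ.map fun x h => x (π.posBase i j x h) := by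
      conv_lhs => rw [hP, hμ, ← (π.symm.measurePreserving_recenter ω j).map_eq, ← hμ]
      rw [Measure.map_map π.measurable_slide (π.symm.measurePreserving_recenter ω j).measurable]
      rfl
    have hmeas : Measurable fun (x : FreeGroup (Fin 2) → W) h => x (π.posBase i j x h) :=
      π.measurable_slide.comp (π.symm.measurePreserving_recenter ω j).measurable
    have hpi : ∀ S : Set (FreeGroup (Fin 2)), MeasurableSet (Set.pi S t) := fun S =>
      .pi S.to_countable fun _ _ => ht _
    rw [hP', Measure.map_apply hmeas (hpi _), Measure.map_apply hmeas (hpi _),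
      Measure.map_apply hmeas (hpi _), ← Set.inter_union_sdiff (s : Set _) (branch i),
      Set.union_pi, Set.preimage_inter]
    rw [Set.inter_union_sdiff]
    refine infinitePi_inter_of_dependsOn ω (branch i) (hmeas (hpi _)) (hmeas (hpi _)) ?_ ?_
    · intro x z hxz hx g hg
      obtain ⟨e, he⟩ := π.posBase_congr_branch hij hxz g hg.2
      have := hx g hg
      simp only at this ⊢
      rwa [← e, ← hxz _ he]
    · intro x z hxz hx g hg
      obtain ⟨e, he⟩ := π.posBase_congr_compl_branch hij hxz g hg.2
      have := hx g hg
      simp only at this ⊢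
      rwa [← e, ← hxz _ he]

end LinePerm

end

/-! ### Matching two sets along the orbits of an ergodic transformation -/

namespace GreedyMatching
variable {Ω : Type*} (T : Equiv.Perm Ω) (P Q : Set Ω) (e : ℕ → ℤ)

/-- The points of `P` and of `Q` that are left unmatched after the first `m` rounds of the greedy
matching along the orbits of `T`, where round `m` matches `x` with `T ^ (e m) x` whenever
possible. -/
def rest : ℕ → Set Ω × Set Ω
  | 0 => (P, Q)
  | m + 1 => ((rest m).1 \ ((rest m).1 ∩ (T ^ e m) ⁻¹' (rest m).2),
      (rest m).2 \ (T ^ (-e m)) ⁻¹' ((rest m).1 ∩ (T ^ e m) ⁻¹' (rest m).2))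

/-- The points of `P` matched in round `m`. -/
def round (m : ℕ) : Set Ω := (rest T P Q e m).1 ∩ (T ^ e m) ⁻¹' (rest T P Q e m).2

theorem rest_succ (m : ℕ) : rest T P Q e (m + 1) =
    ((rest T P Q e m).1 \ round T P Q e m,
      (rest T P Q e m).2 \ (T ^ (-e m)) ⁻¹' round T P Q e m) := rfl

theorem antitone_rest_fst : Antitone fun m => (rest T P Q e m).1 :=
  antitone_nat_of_succ_le fun _ => Set.sdiff_subset

theorem antitone_rest_snd : Antitone fun m => (rest T P Q e m).2 :=
  antitone_nat_of_succ_le fun _ => Set.sdiff_subset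

theorem exists_mem_round {x : Ω} (hx : x ∈ P) (hn : ∃ m, x ∉ (rest T P Q e m).1) :
    ∃ m, x ∈ round T P Q e m := by
  by_contra h
  push Not at h
  obtain ⟨m, hm⟩ := hn
  refine hm ?_
  clear hm
  induction m with
  | zero => exact hx
  | succ m ih => exact ⟨ih, h m⟩

theorem exists_mem_image_round {y : Ω} (hy : y ∈ Q) (hn : ∃ m, y ∉ (rest T P Q e m).2) :
    ∃ m, (T ^ (-e m)) y ∈ round T P Q e m := by
  by_contra h
  push Not at h
  obtain ⟨m, hm⟩ := hn
  refine hm ?_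
  clear hm
  induction m with
  | zero => exact hy
  | succ m ih => exact ⟨ih, h m⟩

theorem round_unique {x : Ω} {m m' : ℕ} (h : x ∈ round T P Q e m)
    (h' : x ∈ round T P Q e m') : m = m' := by
  wlog hlt : m < m' generalizing m m'
  · rcases (not_lt.1 hlt).eq_or_lt with h1 | h1
    · exact h1.symm
    · exact (this h' h h1).symm
  exact absurd h ((antitone_rest_fst T P Q e hlt h'.1).2)

theorem image_round_unique {x x' : Ω} {m m' : ℕ} (h : x ∈ round T P Q e m)
    (h' : x' ∈ round T P Q e m') (heq : (T ^ e m) x = (T ^ e m') x') : m = m' := by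
  wlog hlt : m < m' generalizing m m' x x'
  · rcases (not_lt.1 hlt).eq_or_lt with h1 | h1
    · exact h1.symm
    · exact (this h' h heq.symm h1).symm
  have h1 := (antitone_rest_snd T P Q e hlt h'.2).2
  rw [← heq] at h1
  exact absurd (show (T ^ (-e m)) ((T ^ e m) x) ∈ _ by simpa using h) h1

variable [MeasurableSpace Ω] (μ : Measure Ω) {T P Q e}

theorem measurableSet_rest (hT : ∀ k : ℤ, MeasurePreserving (T ^ k) μ μ) (hP : MeasurableSet P)
    (hQ : MeasurableSet Q) (m : ℕ) :
    MeasurableSet (rest T P Q e m).1 ∧ MeasurableSet (rest T P Q e m).2 := by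
  induction m with
  | zero => exact ⟨hP, hQ⟩
  | succ m ih =>
    have h := ih.1.inter ((hT (e m)).measurable ih.2)
    exact ⟨ih.1.diff h, ih.2.diff ((hT (-e m)).measurable h)⟩

/-- Each round removes from the two sides sets that a power of T carries onto each other. -/
theorem measure_rest_eq [IsFiniteMeasure μ] (hT : ∀ k : ℤ, MeasurePreserving (T ^ k) μ μ) (hP : MeasurableSet P)
    (hQ : MeasurableSet Q) (hPQ : μ P = μ Q) (m : ℕ) :
    μ (rest T P Q e m).1 = μ (rest T P Q e m).2 := by
  induction m with
  | zero => exact hPQ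
  | succ m ih =>
    have hm := measurableSet_rest (e := e) μ hT hP hQ m
    have h : MeasurableSet (round T P Q e m) := hm.1.inter ((hT (e m)).measurable hm.2)
    rw [rest_succ]
    dsimp only
    rw [measure_sdiff (show round T P Q e m ⊆ _ from Set.inter_subset_left) h.nullMeasurableSet (measure_ne_top _ _),
      measure_sdiff _ ((hT (-e m)).measurable h).nullMeasurableSet (measure_ne_top _ _),
      (hT (-e m)).measure_preimage h.nullMeasurableSet, ih]
    intro y hy
    simpa using hy.2

end GreedyMatching

open GreedyMatching in
/-- In an ergodic system, two sets of the same measure are matched, up to null sets, by a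
measurable map that moves points along their orbits: `D k` is the set of points that are moved by
`T ^ k`. -/
theorem exists_matching {Ω : Type*} [MeasurableSpace Ω] (μ : Measure Ω) [IsFiniteMeasure μ]
    (T : Equiv.Perm Ω) (hT : ∀ k : ℤ, MeasurePreserving (T ^ k) μ μ)
    (herg : ∀ B, MeasurableSet B → T ⁻¹' B = B → μ B = 0 ∨ μ Bᶜ = 0)
    {P Q : Set Ω} (hP : MeasurableSet P) (hQ : MeasurableSet Q) (hPQ : μ P = μ Q) :
    ∃ D : ℤ → Set Ω, (∀ k, MeasurableSet (D k)) ∧ (∀ k, D k ⊆ P) ∧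
      (∀ k, ∀ x ∈ D k, (T ^ k) x ∈ Q) ∧
      (∀ k l x, x ∈ D k → x ∈ D l → k = l) ∧
      (∀ k l x y, x ∈ D k → y ∈ D l → (T ^ k) x = (T ^ l) y → k = l) ∧
      μ {x | x ∈ P ∧ ∀ k, x ∉ D k} = 0 ∧ μ {y | y ∈ Q ∧ ∀ k, (T ^ (-k)) y ∉ D k} = 0 := by
  obtain ⟨e, he⟩ := exists_surjective_nat ℤ
  have hm := measurableSet_rest (e := e) μ hT hP hQ
  set P' := ⋂ m, (rest T P Q e m).1 with hP'
  set Q' := ⋂ m, (rest T P Q e m).2 with hQ'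
  have hPQ' : μ P' = μ Q' := by
    refine tendsto_nhds_unique (tendsto_measure_iInter_atTop
      (fun m => (hm m).1.nullMeasurableSet) (antitone_rest_fst T P Q e)
      ⟨0, measure_ne_top _ _⟩) ?_
    have h := tendsto_measure_iInter_atTop (μ := μ) (fun m => (hm m).2.nullMeasurableSet)
      (antitone_rest_snd T P Q e) ⟨0, measure_ne_top _ _⟩
    convert h using 1
    exact funext fun m => measure_rest_eq μ hT hP hQ hPQ m
  have hmP' : MeasurableSet P' := .iInter fun m => (hm m).1
  -- An unmatched point and an unmatched target at distance k on an orbit would have been paired in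
  -- a round that tries k.
  have hdisj : ∀ x ∈ P', ∀ k : ℤ, (T ^ k) x ∉ Q' := by
    intro x hx k hk
    obtain ⟨m, rfl⟩ := he k
    rw [hP', Set.mem_iInter] at hx
    rw [hQ', Set.mem_iInter] at hk
    exact (hx (m + 1)).2 ⟨hx m, hk m⟩
  -- The saturation of P' is invariant. If it is null, so is P'; if it is conull, Q' lies in its
  -- null complement, and P' has the same measure as Q'.
  have hzero : μ P' = 0 := by
    rcases herg (⋃ k : ℤ, (T ^ k) ⁻¹' P') (.iUnion fun k => (hT k).measurable hmP') (by
      ext x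
      simp only [Set.mem_preimage, Set.mem_iUnion]
      constructor
      · rintro ⟨k, hk⟩
        refine ⟨k + 1, ?_⟩
        rw [zpow_add_one]; exact hk
      · rintro ⟨k, hk⟩
        refine ⟨k - 1, ?_⟩
        rw [← Equiv.Perm.mul_apply, ← zpow_add_one, sub_add_cancel]; exact hk) with h | h
    · exact measure_mono_null (fun x hx => Set.mem_iUnion.2 ⟨0, by simpa using hx⟩) h
    · rw [hPQ']
      refine measure_mono_null ?_ h
      intro y hy hy'
      obtain ⟨k, hk⟩ := Set.mem_iUnion.1 hy'
      exact hdisj _ hk (-k) (by simpa using hy)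
  refine ⟨fun k => ⋃ m, ⋃ (_ : e m = k), round T P Q e m, ?_, ?_, ?_, ?_, ?_, ?_, ?_⟩
  · exact fun k => .iUnion fun m => .iUnion fun _ => (hm m).1.inter ((hT (e m)).measurable (hm m).2)
  · intro k x hx
    obtain ⟨m, -, h⟩ := Set.mem_iUnion₂.1 hx
    exact antitone_rest_fst T P Q e (Nat.zero_le m) h.1
  · intro k x hx
    obtain ⟨m, rfl, h⟩ := Set.mem_iUnion₂.1 hx
    exact antitone_rest_snd T P Q e (Nat.zero_le m) h.2
  · intro k l x hx hx'
    obtain ⟨m, rfl, h⟩ := Set.mem_iUnion₂.1 hx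
    obtain ⟨m', rfl, h'⟩ := Set.mem_iUnion₂.1 hx'
    rw [round_unique T P Q e h h']
  · intro k l x y hx hy hxy
    obtain ⟨m, rfl, h⟩ := Set.mem_iUnion₂.1 hx
    obtain ⟨m', rfl, h'⟩ := Set.mem_iUnion₂.1 hy
    rw [image_round_unique T P Q e h h' hxy]
  · refine measure_mono_null (fun x hx => ?_) hzero
    rw [hP', Set.mem_iInter]
    by_contra hc
    push Not at hc
    obtain ⟨m, hm'⟩ := exists_mem_round T P Q e hx.1 hc
    exact hx.2 (e m) (Set.mem_iUnion₂.2 ⟨m, rfl, hm'⟩)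
  · refine measure_mono_null (fun y hy => ?_) (hPQ' ▸ hzero)
    rw [hQ', Set.mem_iInter]
    by_contra hc
    push Not at hc
    obtain ⟨m, hm'⟩ := exists_mem_image_round T P Q e hy.1 hc
    exact hy.2 (e m) (Set.mem_iUnion₂.2 ⟨m, rfl, hm'⟩)

/-! ### Ergodicity of skew products over the shift -/

section SkewProduct
variable {W : Type*} {n : ℕ} (s : W → ZMod n)

/-- The skew product over the shift of `W ^ ℤ` that adds `s (w 0)` in the fibre `ZMod n`. -/
def skewShift : Equiv.Perm ((ℤ → W) × ZMod n) where
  toFun p := (fun m => p.1 (m + 1), p.2 + s (p.1 0))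
  invFun p := (fun m => p.1 (m - 1), p.2 - s (p.1 (-1)))
  left_inv p := by simp
  right_inv p := by simp

/-- The sum of the values of `s` along `w` from `0` to `m`. -/
def potential (w : ℤ → W) (m : ℤ) : ZMod n := ((skewShift s ^ m) (w, 0)).2

theorem skewShift_zpow_fst (m : ℤ) (p : (ℤ → W) × ZMod n) :
    ((skewShift s ^ m) p).1 = fun l => p.1 (l + m) := by
  induction m using Int.induction_on generalizing p with
  | zero => simp
  | succ m ih =>
    rw [zpow_add_one, Equiv.Perm.mul_apply, ih]
    ext l
    simp [skewShift, add_assoc]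
  | pred m ih =>
    rw [zpow_sub_one, Equiv.Perm.mul_apply, ih]
    ext l
    change p.1 (l + -m - 1) = p.1 (l + (-m - 1))
    rw [add_sub_assoc]

theorem skewShift_zpow_add (m : ℤ) (p : (ℤ → W) × ZMod n) (κ : ZMod n) :
    (skewShift s ^ m) (p.1, p.2 + κ) =
      (((skewShift s ^ m) p).1, ((skewShift s ^ m) p).2 + κ) := by
  induction m using Int.induction_on generalizing p with
  | zero => simp
  | succ m ih =>
    rw [zpow_add_one, Equiv.Perm.mul_apply, Equiv.Perm.mul_apply, ← ih]
    simp [skewShift, add_right_comm]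
  | pred m ih =>
    rw [zpow_sub_one, Equiv.Perm.mul_apply, Equiv.Perm.mul_apply, ← ih]
    simp [skewShift, Equiv.Perm.inv_def, add_sub_right_comm]

theorem skewShift_zpow_apply (m : ℤ) (w : ℤ → W) (κ : ZMod n) :
    (skewShift s ^ m) (w, κ) = (fun l => w (l + m), κ + potential s w m) := by
  have h := skewShift_zpow_add s m (w, 0) κ
  simp only [zero_add] at h
  rw [h, skewShift_zpow_fst, add_comm, potential]

@[simp] theorem potential_zero (w : ℤ → W) : potential s w 0 = 0 := by simp [potential]

theorem potential_add_one (w : ℤ → W) (m : ℤ) :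
    potential s w (m + 1) = potential s w m + s (w m) := by
  have h := skewShift_zpow_apply s m w 0
  rw [potential, add_comm m 1, zpow_add, zpow_one, Equiv.Perm.mul_apply, h]
  simp [skewShift]

theorem potential_natCast (w : ℤ → W) (N : ℕ) :
    potential s w N = ∑ l ∈ Finset.range N, s (w l) := by
  induction N with
  | zero => simp
  | succ N ih => rw [Finset.sum_range_succ, ← ih, ← potential_add_one]; simp

theorem potential_eq_of_step (f : ℤ → ZMod n) (w : ℤ → W) (h0 : f 0 = 0)
    (h : ∀ m, f (m + 1) = f m + s (w m)) : f = potential s w := by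
  ext m
  induction m using Int.induction_on with
  | zero => simp [h0]
  | succ m ih => rw [h, potential_add_one, ih]
  | pred m ih =>
    have h1 := h (-m - 1)
    have h2 := potential_add_one s w (-m - 1)
    rw [sub_add_cancel] at h1 h2
    rw [h1, h2] at ih
    exact add_right_cancel ih

variable [MeasurableSpace W]

/-- Membership in `C` depends only on the coordinates in `[-R, R]`, and on the fibre. -/
def DependsOnWindow (R : ℕ) (C : Set ((ℤ → W) × ZMod n)) : Prop :=
  ∀ κ w w', (∀ l : ℤ, |l| ≤ R → w l = w' l) → (w, κ) ∈ C → (w', κ) ∈ C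

/-- Window sets approximate all measurable sets and become independent when shifted far apart, so a
mixing estimate is needed for them only. -/
theorem isSetAlgebra_window : IsSetAlgebra
    {C : Set ((ℤ → W) × ZMod n) | MeasurableSet C ∧ ∃ R, DependsOnWindow R C} where
  empty_mem := ⟨.empty, 0, fun _ _ _ _ h => h⟩
  compl_mem := fun C ⟨hC, R, hR⟩ => ⟨hC.compl, R, fun κ w w' h hw hw' =>
    hw (hR κ w' w (fun l hl => (h l hl).symm) hw')⟩
  union_mem := by
    rintro C D ⟨hC, R, hR⟩ ⟨hD, R', hR'⟩
    refine ⟨hC.union hD, max R R', fun κ w w' h hw => hw.imp ?_ ?_⟩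
    · exact hR κ w w' fun l hl => h l (hl.trans (by simp))
    · exact hR' κ w w' fun l hl => h l (hl.trans (by simp))

theorem generateFrom_window : MeasurableSpace.generateFrom
    {C : Set ((ℤ → W) × ZMod n) | MeasurableSet C ∧ ∃ R, DependsOnWindow R C} =
      (inferInstance : MeasurableSpace ((ℤ → W) × ZMod n)) := by
  refine le_antisymm (MeasurableSpace.generateFrom_le fun C hC => hC.1) ?_
  refine sup_le ?_ ?_
  · rw [← measurable_iff_comap_le, @measurable_pi_iff]
    intro l E hE
    refine MeasurableSpace.measurableSet_generateFrom ⟨?_, l.natAbs, ?_⟩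
    · exact ((measurable_pi_apply l).comp measurable_fst) hE
    · intro κ w w' h hw
      have := h l (by simp)
      simp only [Set.mem_preimage] at hw ⊢
      rwa [← this]
  · rw [← measurable_iff_comap_le]
    intro E hE
    exact MeasurableSpace.measurableSet_generateFrom
      ⟨measurable_snd hE, 0, fun κ w w' h hw => hw⟩

/-- Two window sets, one of them shifted far away, are independent. -/
theorem window_indep (ω : Measure W) [IsProbabilityMeasure ω] {R : ℕ} {C : Set ((ℤ → W) × ZMod n)} (hC : MeasurableSet C)
    (hR : DependsOnWindow R C) {N : ℤ} (hN : 2 * R < N) (κ κ' : ZMod n) :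
    Measure.infinitePi (fun _ : ℤ => ω) ({w | (w, κ) ∈ C} ∩ {w | ((fun l => w (l + N)), κ') ∈ C}) =
      Measure.infinitePi (fun _ : ℤ => ω) {w | (w, κ) ∈ C} *
        Measure.infinitePi (fun _ : ℤ => ω) {w | (w, κ') ∈ C} := by
  have hsec : ∀ κ, MeasurableSet {w | (w, κ) ∈ C} := fun κ => measurable_prodMk_right hC
  have hsh := measurePreserving_reindex ω (Equiv.addRight N)
  have e : {w : ℤ → W | ((fun l => w (l + N)), κ') ∈ C} =
      (fun w l => w (Equiv.addRight N l)) ⁻¹' {w | (w, κ') ∈ C} := rfl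
  rw [infinitePi_inter_of_dependsOn ω {l : ℤ | |l| ≤ R} (hsec κ) (e ▸ hsh.measurable (hsec κ')),
    e, hsh.measure_preimage (hsec κ').nullMeasurableSet]
  · exact fun x z h hx => hR κ x z h hx
  · intro x z h hx
    refine hR κ' _ _ (fun l hl => h _ ?_) hx
    rw [abs_le] at hl
    simp only [Set.mem_ofPred_eq, abs_le]
    omega

variable {s} [NeZero n]

theorem measurable_skewShift (hs : Measurable s) : Measurable (skewShift s) := by
  refine Measurable.prodMk (by fun_prop) ?_
  exact measurable_snd.add (hs.comp ((measurable_pi_apply 0).comp measurable_fst))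

theorem measurable_skewShift_symm (hs : Measurable s) : Measurable (skewShift s).symm := by
  refine Measurable.prodMk (by fun_prop) ?_
  exact measurable_snd.sub (hs.comp ((measurable_pi_apply (-1)).comp measurable_fst))

variable (ω : Measure W) [IsProbabilityMeasure ω]

/-- The product measure on `W ^ ℤ × ZMod n` that is preserved by `skewShift`. -/
noncomputable def skewMeasure (n : ℕ) [NeZero n] : Measure ((ℤ → W) × ZMod n) :=
  (Measure.infinitePi fun _ : ℤ => ω).prod Measure.count

instance : IsFiniteMeasure (skewMeasure ω n) := by
  unfold skewMeasure; infer_instance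

theorem skewMeasure_apply {C : Set ((ℤ → W) × ZMod n)} (hC : MeasurableSet C) :
    skewMeasure ω n C = ∑ κ, Measure.infinitePi (fun _ : ℤ => ω) {w | (w, κ) ∈ C} := by
  rw [skewMeasure, Measure.prod_apply_symm hC, lintegral_count, tsum_fintype]
  rfl

/-- The fibre carries counting measure, not a probability measure; this accounts for the factor n in
the mixing inequalities. -/
theorem skewMeasure_univ : skewMeasure ω n Set.univ = n := by
  rw [skewMeasure_apply ω .univ]
  simp

theorem measurePreserving_skewShift_zpow (hs : Measurable s) (m : ℤ) :
    MeasurePreserving (skewShift s ^ m) (skewMeasure ω n) (skewMeasure ω n) := by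
  have h1 : MeasurePreserving (skewShift s) (skewMeasure ω n) (skewMeasure ω n) := by
    refine (measurePreserving_reindex ω (Equiv.addRight (1 : ℤ))).skew_product
      (g := fun w κ => κ + s (w 0)) ?_ ?_
    · exact measurable_snd.add (hs.comp ((measurable_pi_apply 0).comp measurable_fst))
    · exact ae_of_all _ fun w => (measurePreserving_add_right Measure.count (s (w 0))).map_eq
  let e : ((ℤ → W) × ZMod n) ≃ᵐ ((ℤ → W) × ZMod n) :=
    ⟨skewShift s, measurable_skewShift hs, measurable_skewShift_symm hs⟩
  have h2 : MeasurePreserving ((skewShift s)⁻¹ : Equiv.Perm _) (skewMeasure ω n) (skewMeasure ω n) :=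
    MeasurePreserving.symm e h1
  induction m using Int.induction_on with
  | zero => exact MeasurePreserving.id _
  | succ m ih => rw [zpow_add_one]; exact ih.comp h1
  | pred m ih => rw [zpow_sub_one]; exact ih.comp h2

/-- Ergodicity of the skew product, from a mixing inequality for window sets. -/
theorem skewShift_ergodic (hs : Measurable s)
    (hmix : ∀ (R : ℕ) (C : Set ((ℤ → W) × ZMod n)), MeasurableSet C → DependsOnWindow R C →
      ∃ N : ℤ, n * skewMeasure ω n (C ∩ (skewShift s ^ N) ⁻¹' C) ≤ skewMeasure ω n C ^ 2)
    {B : Set ((ℤ → W) × ZMod n)} (hB : MeasurableSet B) (hinv : skewShift s ⁻¹' B = B) :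
    skewMeasure ω n B = 0 ∨ skewMeasure ω n Bᶜ = 0 := by
  set ν := skewMeasure ω n with hν
  have hinvN : ∀ N : ℤ, (skewShift s ^ N) ⁻¹' B = B := by
    intro N
    induction N using Int.induction_on with
    | zero => simp
    | succ N ih => rw [zpow_add_one, Equiv.Perm.coe_mul, Set.preimage_comp, ih, hinv]
    | pred N ih =>
      rw [zpow_sub_one, Equiv.Perm.coe_mul, Set.preimage_comp, ih]
      nth_rw 1 [← hinv]
      rw [← Set.preimage_comp, ← Equiv.Perm.coe_mul, mul_inv_cancel]
      rfl
  have hn : (0 : ℝ) < n := by exact_mod_cast Nat.pos_of_ne_zero (NeZero.ne n)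
  -- For a window set C within ε of the invariant set B, the part of B outside C ∩ T⁻ᴺ C is covered
  -- by two sets of measure at most ε.
  have key : ∀ ε : ℝ, 0 < ε → n * ν.real B ≤ (ν.real B + ε) ^ 2 + 2 * n * ε := by
    intro ε hε
    obtain ⟨C, ⟨hC, R, hR⟩, hCB⟩ := exists_measure_symmDiff_lt_of_generateFrom_isSetRing (μ := ν)
      isSetAlgebra_window.isSetRing ⟨{Set.univ}, by simp, by
        simpa using isSetAlgebra_window.univ_mem, by simp⟩ generateFrom_window.symm hB
      (ENNReal.ofReal_pos.2 hε)
    obtain ⟨N, hN⟩ := hmix R C hC hR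
    have hCB' : ν.real (symmDiff C B) ≤ ε :=
      ENNReal.toReal_le_of_le_ofReal hε.le hCB.le
    have hN' : n * ν.real (C ∩ (skewShift s ^ N) ⁻¹' C) ≤ ν.real C ^ 2 := by
      have := ENNReal.toReal_mono (by simp) hN
      simpa [Measure.real] using this
    have h1 : ν.real B ≤ ν.real (C ∩ (skewShift s ^ N) ⁻¹' C) + ε + ε := by
      calc ν.real B ≤ ν.real ((C ∩ (skewShift s ^ N) ⁻¹' C) ∪ symmDiff C B ∪
            (skewShift s ^ N) ⁻¹' symmDiff C B) := by
            refine measureReal_mono fun x hx => ?_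
            have hx' : (skewShift s ^ N) x ∈ B := by
              rw [← hinvN N] at hx; exact hx
            simp only [Set.mem_union, Set.mem_inter_iff, Set.mem_preimage, Set.mem_symmDiff]
            tauto
        _ ≤ ν.real (C ∩ (skewShift s ^ N) ⁻¹' C) + ν.real (symmDiff C B) +
            ν.real ((skewShift s ^ N) ⁻¹' symmDiff C B) :=
            (measureReal_union_le _ _).trans (by gcongr; exact measureReal_union_le _ _)
        _ ≤ _ := by
            rw [(measurePreserving_skewShift_zpow ω hs N).measureReal_preimage
              (hC.symmDiff hB).nullMeasurableSet]
            gcongr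
    have h2 : ν.real C ≤ ν.real B + ε := by
      calc ν.real C ≤ ν.real (B ∪ symmDiff C B) := by
            refine measureReal_mono fun x hx => ?_
            simp only [Set.mem_union, Set.mem_symmDiff]
            tauto
        _ ≤ ν.real B + ν.real (symmDiff C B) := measureReal_union_le _ _
        _ ≤ _ := by gcongr
    have h3 : ν.real C ^ 2 ≤ (ν.real B + ε) ^ 2 := by gcongr
    nlinarith
  have hle : n * ν.real B ≤ ν.real B ^ 2 := by
    by_contra hcon
    push Not at hcon
    set x := ν.real B with hx
    have hx0 : 0 ≤ x := measureReal_nonneg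
    set δ := n * x - x ^ 2 with hδ
    have hδ0 : 0 < δ := by rw [hδ]; linarith
    -- For ε ≤ 1 the error (x + ε)² - x² + 2nε is at most ε(2x + 2n + 1), so this divisor makes it
    -- strictly smaller than δ.
    have hd : (0 : ℝ) < 2 * x + 2 * n + 2 := by positivity
    have hε : 0 < min 1 (δ / (2 * x + 2 * n + 2)) := by positivity
    have h1 := key _ hε
    set ε := min 1 (δ / (2 * x + 2 * n + 2)) with hε'
    have h2 : ε ≤ 1 := min_le_left _ _
    have h3 : ε * (2 * x + 2 * n + 2) ≤ δ := (le_div_iff₀ hd).1 (min_le_right _ _)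
    nlinarith
  have huniv : ν.real Set.univ = n := by
    rw [Measure.real, hν, skewMeasure_univ]; simp
  have hsum := measureReal_add_measureReal_compl (μ := ν) hB
  rw [huniv] at hsum
  have hB0 : 0 ≤ ν.real B := measureReal_nonneg
  have hBc0 : 0 ≤ ν.real Bᶜ := measureReal_nonneg
  have hprod : ν.real B * ν.real Bᶜ = 0 := by
    have : ν.real B * ν.real Bᶜ ≤ 0 := by
      have : ν.real Bᶜ = n - ν.real B := by linarith
      rw [this]; nlinarith
    exact le_antisymm this (by positivity)
  rcases mul_eq_zero.1 hprod with h | h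
  · exact Or.inl ((measureReal_eq_zero_iff).1 h)
  · exact Or.inr ((measureReal_eq_zero_iff).1 h)

theorem measure_eq_sum_fiber {X V : Type*} [MeasurableSpace X] [MeasurableSpace V] [Fintype V]
    [MeasurableSingletonClass V] (μ : Measure X) (E : Set X) {f : X → V} (hf : Measurable f) :
    μ E = ∑ v, μ (E ∩ {x | f x = v}) := by
  classical
  have h : E = ⋃ v ∈ (Finset.univ : Finset V), E ∩ {x | f x = v} := by ext; simp
  have hm : ∀ v, MeasurableSet {x | f x = v} := fun v => hf (measurableSet_singleton v)
  have h2 := measure_biUnion_finset₀ (μ := μ.restrict E) (s := (Finset.univ : Finset V))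
    (f := fun v => {x | f x = v}) ?_ fun v _ => (hm v).nullMeasurableSet
  · have h3 : (⋃ v ∈ (Finset.univ : Finset V), {x | f x = v}) = Set.univ := by ext; simp
    rw [h3, Measure.restrict_apply_univ] at h2
    rw [h2]
    exact Finset.sum_congr rfl fun v _ => by rw [Measure.restrict_apply (hm v), Set.inter_comm]
  · intro u _ v _ huv
    exact (Set.disjoint_left.2 fun x hx hx' => huv (hx.symm.trans hx')).aedisjoint

/-- Ergodicity of the skew product if `s` is uniformly distributed. -/
theorem skewShift_mixing_of_uniform (hs : Measurable s)
    (hunif : ∀ κ, ω (s ⁻¹' {κ}) = (n : ENNReal)⁻¹) (R : ℕ) (C : Set ((ℤ → W) × ZMod n))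
    (hC : MeasurableSet C) (hR : DependsOnWindow R C) :
    ∃ N : ℤ, n * skewMeasure ω n (C ∩ (skewShift s ^ N) ⁻¹' C) ≤ skewMeasure ω n C ^ 2 := by
  classical
  set μ := Measure.infinitePi fun _ : ℤ => ω with hμ
  -- The windows [-R, R] and [N - R, N + R] leave the coordinate R + 1 free. Its uniform
  -- contribution to the potential makes the shift in the fibre uniform and independent of both
  -- windows.
  set N : ℕ := 2 * R + 2 with hN
  refine ⟨N, le_of_eq ?_⟩
  have hsec : ∀ κ, MeasurableSet {w | (w, κ) ∈ C} := fun κ => measurable_prodMk_right hC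
  have hshift : Measurable fun (w : ℤ → W) l => w (l + (N : ℤ)) := by fun_prop
  set I := (Finset.range N).erase (R + 1) with hI
  have hmem : R + 1 ∈ Finset.range N := by rw [Finset.mem_range]; omega
  set ρ : (ℤ → W) → ZMod n := fun w => ∑ l ∈ I, s (w l) with hρ
  have hρm : Measurable ρ := Finset.measurable_sum _ fun l _ => hs.comp (measurable_pi_apply _)
  have hpot : ∀ w, potential s w N = ρ w + s (w ((R + 1 : ℕ) : ℤ)) := by
    intro w
    rw [potential_natCast, ← Finset.sum_erase_add _ _ hmem]
  have hpm : ∀ κ, Measurable fun w => κ + potential s w N := by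
    intro κ
    simp_rw [hpot]
    exact measurable_const.add (hρm.add (hs.comp (measurable_pi_apply _)))
  have hsec' : ∀ κ, {w | (w, κ) ∈ C ∩ (skewShift s ^ (N : ℤ)) ⁻¹' C} =
      {w | (w, κ) ∈ C ∧ (fun l => w (l + (N : ℤ)), κ + potential s w N) ∈ C} := by
    intro κ
    ext w
    simp only [Set.mem_inter_iff, Set.mem_preimage, skewShift_zpow_apply]
  have hunif' : ∀ κ, μ {w | s (w ((R + 1 : ℕ) : ℤ)) = κ} = (n : ENNReal)⁻¹ := by
    intro κ
    rw [← hunif κ, ← (measurePreserving_eval_infinitePi (fun _ : ℤ => ω)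
      ((R + 1 : ℕ) : ℤ)).measure_preimage (hs (measurableSet_singleton κ)).nullMeasurableSet]
    rfl
  have hterm : ∀ κ κ' r, μ ((({w | (w, κ) ∈ C ∧
      (fun l => w (l + (N : ℤ)), κ + potential s w N) ∈ C}) ∩
        {w | κ + potential s w N = κ'}) ∩ {w | ρ w = r}) =
      μ (({w | (w, κ) ∈ C} ∩ {w | ((fun l => w (l + (N : ℤ))), κ') ∈ C}) ∩ {w | ρ w = r}) *
        (n : ENNReal)⁻¹ := by
    intro κ κ' r
    rw [← hunif' (κ' - κ - r), ← infinitePi_inter_of_dependsOn ω {((R + 1 : ℕ) : ℤ)}ᶜ]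
    · congr 1
      ext w
      simp only [Set.mem_inter_iff, Set.mem_ofPred_eq, hpot]
      constructor
      · rintro ⟨⟨⟨h1, h2⟩, h3⟩, h4⟩
        rw [h3] at h2
        refine ⟨⟨⟨h1, h2⟩, h4⟩, ?_⟩
        rw [← h3, ← h4]; ring
      · rintro ⟨⟨⟨h1, h2⟩, h4⟩, h5⟩
        have h3 : κ + (ρ w + s (w ((R + 1 : ℕ) : ℤ))) = κ' := by rw [h5, h4]; ring
        exact ⟨⟨⟨h1, h3 ▸ h2⟩, h3⟩, h4⟩
    · exact ((hsec κ).inter (hshift (hsec κ'))).inter (hρm (measurableSet_singleton r))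
    · exact hs.comp (measurable_pi_apply _) (measurableSet_singleton _)
    · rintro x z h ⟨⟨h1, h2⟩, h3⟩
      refine ⟨⟨hR _ _ _ (fun l hl => h l ?_) h1, hR _ _ _ (fun l hl => h _ ?_) h2⟩, ?_⟩
      · rw [abs_le] at hl
        simp only [Set.mem_compl_iff, Set.mem_singleton_iff]
        omega
      · rw [abs_le] at hl
        simp only [Set.mem_compl_iff, Set.mem_singleton_iff]
        omega
      · rw [Set.mem_ofPred_eq, ← show ρ x = r from h3]
        refine Finset.sum_congr rfl fun l hl => ?_
        rw [h l]
        have := (Finset.mem_erase.1 hl).1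
        simp only [Set.mem_compl_iff, Set.mem_singleton_iff]
        exact_mod_cast this
    · intro x z h hx
      have := h ((R + 1 : ℕ) : ℤ) (by simp)
      simp only [Set.mem_ofPred_eq] at hx ⊢
      rwa [← this]
  have hrow : ∀ κ, μ {w | (w, κ) ∈ C ∩ (skewShift s ^ (N : ℤ)) ⁻¹' C} =
      ∑ κ', μ {w | (w, κ) ∈ C} * μ {w | (w, κ') ∈ C} * (n : ENNReal)⁻¹ := by
    intro κ
    rw [hsec', measure_eq_sum_fiber μ _ (hpm κ)]
    refine Finset.sum_congr rfl fun κ' _ => ?_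
    rw [measure_eq_sum_fiber μ _ hρm, Finset.sum_congr rfl fun r _ => hterm κ κ' r,
      ← Finset.sum_mul, ← measure_eq_sum_fiber μ _ hρm,
      window_indep ω hC hR (by rw [hN]; push_cast; omega)]
  rw [skewMeasure_apply ω hC, skewMeasure_apply ω (hC.inter
    ((measurePreserving_skewShift_zpow ω hs N).measurable hC)),
    Finset.sum_congr rfl fun κ _ => hrow κ, pow_two, Finset.sum_mul_sum, Finset.mul_sum]
  refine Finset.sum_congr rfl fun κ _ => ?_
  rw [Finset.mul_sum]
  refine Finset.sum_congr rfl fun κ' _ => ?_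
  rw [mul_left_comm, ENNReal.mul_inv_cancel (by simp [NeZero.ne n]) (by simp), mul_one]

/-- Ergodicity of the skew product if `s` is the constant function `1`. -/
theorem skewShift_mixing_of_one (R : ℕ) (C : Set ((ℤ → W) × ZMod n))
    (hC : MeasurableSet C) (hR : DependsOnWindow R C) :
    ∃ N : ℤ, n * skewMeasure ω n (C ∩ (skewShift (fun _ : W => (1 : ZMod n)) ^ N) ⁻¹' C) ≤
      skewMeasure ω n C ^ 2 := by
  set μ := Measure.infinitePi fun _ : ℤ => ω with hμ
  set s : W → ZMod n := fun _ => 1 with hs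
  have hsm : Measurable s := measurable_const
  -- These times exceed 2R and are congruent to v modulo n, so the fibre is rotated by v. A rotation
  -- need not mix at a given time, but averaging over v yields the product exactly, so some v does
  -- no worse.
  have hN : ∀ v : ZMod n, skewMeasure ω n
      (C ∩ (skewShift s ^ ((2 * R * n + n + v.val : ℕ) : ℤ)) ⁻¹' C) =
        ∑ κ, μ {w | (w, κ) ∈ C} * μ {w | (w, κ + v) ∈ C} := by
    intro v
    rw [skewMeasure_apply ω (hC.inter ((measurePreserving_skewShift_zpow ω hsm _).measurable hC))]
    refine Finset.sum_congr rfl fun κ _ => ?_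
    have hlt : (2 * R : ℤ) < ((2 * R * n + n + v.val : ℕ) : ℤ) := by
      have h1 : 1 ≤ n := Nat.one_le_iff_ne_zero.2 (NeZero.ne n)
      have h2 : 2 * R * 1 ≤ 2 * R * n := Nat.mul_le_mul_left _ h1
      push_cast at h2 ⊢
      have h3 : (2 * R * 1 : ℤ) ≤ 2 * R * n := by exact_mod_cast h2
      omega
    rw [← window_indep ω hC hR hlt]
    congr 1
    ext w
    have hp : potential s w ((2 * R * n + n + v.val : ℕ) : ℤ) = v := by
      rw [potential_natCast]
      simp [hs]
    change (w, κ) ∈ C ∧ (skewShift s ^ ((2 * R * n + n + v.val : ℕ) : ℤ)) (w, κ) ∈ C ↔ _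
    rw [skewShift_zpow_apply, hp]
    rfl
  have hsum : ∑ v : ZMod n, skewMeasure ω n
      (C ∩ (skewShift s ^ ((2 * R * n + n + v.val : ℕ) : ℤ)) ⁻¹' C) = skewMeasure ω n C ^ 2 := by
    rw [Finset.sum_congr rfl fun v _ => hN v, Finset.sum_comm, skewMeasure_apply ω hC, pow_two,
      Finset.sum_mul_sum]
    refine Finset.sum_congr rfl fun κ _ => ?_
    exact Equiv.sum_comp (Equiv.addLeft κ) fun κ' => μ {w | (w, κ) ∈ C} * μ {w | (w, κ') ∈ C}
  by_contra hcon
  push Not at hcon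
  have h1 : ∑ v : ZMod n, skewMeasure ω n C ^ 2 < ∑ v : ZMod n, n * skewMeasure ω n
      (C ∩ (skewShift s ^ ((2 * R * n + n + v.val : ℕ) : ℤ)) ⁻¹' C) :=
    ENNReal.sum_lt_sum_of_nonempty Finset.univ_nonempty fun v _ => hcon _
  rw [← Finset.mul_sum, hsum] at h1
  simp at h1

end SkewProduct

/-! ### Equivariant permutations of ℤ from matchings -/

open Classical in
/-- The permutation of `ℤ` whose graph is the relation `rel`, if there is one, and the identity
otherwise. -/
noncomputable def permOfRel (rel : ℤ → ℤ → Prop) : Equiv.Perm ℤ :=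
  if h : ∃ σ : Equiv.Perm ℤ, ∀ i j, σ i = j ↔ rel i j then h.choose else 1

theorem permOfRel_apply {rel : ℤ → ℤ → Prop} (h1 : ∀ i, ∃ j, rel i j) (h2 : ∀ j, ∃ i, rel i j)
    (h3 : ∀ i j j', rel i j → rel i j' → j = j') (h4 : ∀ i i' j, rel i j → rel i' j → i = i')
    (i j : ℤ) : permOfRel rel i = j ↔ rel i j := by
  have h : ∃ σ : Equiv.Perm ℤ, ∀ i j, σ i = j ↔ rel i j := by
    choose f hf using h1
    choose g hg using h2
    refine ⟨⟨f, g, fun i => h4 _ _ _ (hg _) (hf i), fun j => h3 _ _ _ (hf _) (hg j)⟩,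
      fun i j => ⟨?_, fun hij => h3 _ _ _ (hf i) hij⟩⟩
    rintro rfl
    exact hf i
  rw [permOfRel, dif_pos h]
  exact h.choose_spec i j

theorem permOfRel_of_not {rel : ℤ → ℤ → Prop}
    (h : ¬ ((∀ i, ∃ j, rel i j) ∧ ∀ j, ∃ i, rel i j)) : permOfRel rel = 1 := by
  rw [permOfRel, dif_neg]
  rintro ⟨σ, hσ⟩
  exact h ⟨fun i => ⟨σ i, (hσ _ _).1 rfl⟩, fun j => ⟨σ.symm j, (hσ _ _).1 (by simp)⟩⟩

/-- If the skew product given by `s` is ergodic, one can choose permutations of `ℤ` equivariantly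
such that the class of a point, given by the sum of `s` up to that point, becomes the class of
its image, where the latter is corrected by `r`. -/
theorem exists_linePerm {W : Type*} [MeasurableSpace W] (ω : Measure W) [IsProbabilityMeasure ω]
    {n : ℕ} [NeZero n] {s r : W → ZMod n} (hs : Measurable s) (hr : Measurable r) (c : ZMod n)
    (herg : ∀ B : Set ((ℤ → W) × ZMod n), MeasurableSet B → skewShift s ⁻¹' B = B →
      skewMeasure ω n B = 0 ∨ skewMeasure ω n Bᶜ = 0) :
    ∃ π : LinePerm W, ∀ᵐ w ∂(Measure.infinitePi fun _ : ℤ => ω),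
      potential s w (π.perm w 0) + r (w (π.perm w 0)) = c := by
  set μ := Measure.infinitePi fun _ : ℤ => ω with hμ
  -- Going from the fibre -c to a point where fibre plus r vanishes means that the potential
  -- collected on the way plus r equals c. Each of the two sets has one point over every w, hence
  -- measure 1.
  have hP : MeasurableSet {p : (ℤ → W) × ZMod n | p.2 = -c} :=
    measurable_snd (measurableSet_singleton (-c))
  have hQm : Measurable fun p : (ℤ → W) × ZMod n => p.2 + r (p.1 0) :=
    measurable_snd.add (hr.comp ((measurable_pi_apply 0).comp measurable_fst))
  have hQ : MeasurableSet {p : (ℤ → W) × ZMod n | p.2 + r (p.1 0) = 0} :=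
    hQm (measurableSet_singleton 0)
  have hPQ : skewMeasure ω n {p | p.2 = -c} = skewMeasure ω n {p | p.2 + r (p.1 0) = 0} := by
    rw [skewMeasure_apply ω hP, skewMeasure_apply ω hQ]
    have h1 : ∑ κ : ZMod n, μ {w : ℤ → W | κ = -c} = 1 := by
      rw [Finset.sum_eq_single (-c)]
      · simp
      · intro κ _ hκ; simp [hκ]
      · simp
    have h2 : ∑ κ : ZMod n, μ {w : ℤ → W | κ + r (w 0) = 0} = 1 := by
      have hm : Measurable fun w : ℤ → W => -r (w 0) :=
        (hr.comp (measurable_pi_apply 0)).neg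
      rw [← measure_univ (μ := μ), measure_eq_sum_fiber μ Set.univ hm]
      refine Finset.sum_congr rfl fun κ _ => ?_
      congr 1
      ext w
      simp only [Set.mem_ofPred_eq, Set.univ_inter]
      rw [neg_eq_iff_add_eq_zero, add_comm]
    exact h1.trans h2.symm
  obtain ⟨D, hDm, hDP, hDQ, huniq, huniq', hnull, hnull'⟩ := exists_matching
    (skewMeasure ω n) (skewShift s) (measurePreserving_skewShift_zpow ω hs) herg hP hQ hPQ
  -- Over each shift of w lies exactly one starting point and one target, so the matching descends
  -- to a relation between positions in ℤ.
  set rel : (ℤ → W) → ℤ → ℤ → Prop := fun w i j => ((fun m => w (m + i)), -c) ∈ D (j - i)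
    with hrel
  have hshift : ∀ (w : ℤ → W) (t i j : ℤ),
      rel (fun m => w (m + t)) i j ↔ rel w (i + t) (j + t) := by
    intro w t i j
    simp only [hrel, add_sub_add_right_eq_sub, add_assoc]
  have hrm : ∀ i j, MeasurableSet {w | rel w i j} := by
    intro i j
    have : Measurable fun w : ℤ → W => ((fun m => w (m + i)), -c) := by fun_prop
    exact this (hDm _)
  have h3 : ∀ w i j j', rel w i j → rel w i j' → j = j' := by
    intro w i j j' h h'
    have := huniq _ _ _ h h'
    omega
  have himg : ∀ w i j, rel w i j → (skewShift s ^ (j - i)) ((fun m => w (m + i)), -c) =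
      ((fun m => w (m + j)), -r (w j)) := by
    intro w i j h
    have hq := hDQ _ _ h
    rw [skewShift_zpow_apply] at hq ⊢
    simp only [Set.mem_ofPred_eq, zero_add, sub_add_cancel] at hq
    rw [eq_neg_of_add_eq_zero_left hq]
    congr 1
    ext m
    congr 1
    ring
  have h4 : ∀ w i i' j, rel w i j → rel w i' j → i = i' := by
    intro w i i' j h h'
    have := huniq' _ _ _ _ h h' ((himg _ _ _ h).trans (himg _ _ _ h').symm)
    omega
  -- This set is conull and shift-invariant, so using the identity permutation off it does not spoil
  -- equivariance.
  set good : Set (ℤ → W) := {w | (∀ i, ∃ j, rel w i j) ∧ ∀ j, ∃ i, rel w i j} with hgood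
  have hgoodm : MeasurableSet good := by
    have : good = (⋂ i, ⋃ j, {w | rel w i j}) ∩ ⋂ j, ⋃ i, {w | rel w i j} := by
      ext w; simp [hgood]
    rw [this]
    exact (MeasurableSet.iInter fun i => .iUnion fun j => hrm i j).inter
      (.iInter fun j => .iUnion fun i => hrm i j)
  have hgs : ∀ w t, (fun m => w (m + t)) ∈ good ↔ w ∈ good := by
    intro w t
    simp only [hgood, Set.mem_ofPred_eq, hshift]
    refine and_congr ⟨fun h i => ?_, fun h i => ?_⟩ ⟨fun h i => ?_, fun h i => ?_⟩
    · obtain ⟨j, hj⟩ := h (i - t); exact ⟨j + t, by simpa using hj⟩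
    · obtain ⟨j, hj⟩ := h (i + t); exact ⟨j - t, by simpa using hj⟩
    · obtain ⟨j, hj⟩ := h (i - t); exact ⟨j + t, by simpa using hj⟩
    · obtain ⟨j, hj⟩ := h (i + t); exact ⟨j - t, by simpa using hj⟩
  have happ : ∀ w ∈ good, ∀ i j, permOfRel (rel w) i = j ↔ rel w i j := fun w hw i j =>
    permOfRel_apply hw.1 hw.2 (h3 w) (h4 w) i j
  have hbad : ∀ w ∉ good, permOfRel (rel w) = 1 := fun w hw => permOfRel_of_not hw
  have hae : ∀ᵐ w ∂μ, w ∈ good := by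
    have hsec : ∀ N : Set ((ℤ → W) × ZMod n), skewMeasure ω n N = 0 →
        ∀ᵐ w ∂μ, ∀ κ, (w, κ) ∉ N := by
      intro N hN
      rw [skewMeasure] at hN
      filter_upwards [Measure.ae_ae_of_ae_prod (measure_eq_zero_iff_ae_notMem.1 hN)] with w hw κ
      exact (Measure.ae_count_iff.1 hw) κ
    have hsh : ∀ t : ℤ, MeasurePreserving (fun (w : ℤ → W) m => w (m + t)) μ μ := fun t =>
      measurePreserving_reindex ω (Equiv.addRight t)
    have ha := ae_all_iff.2 fun t : ℤ => (hsh t).quasiMeasurePreserving.ae (hsec _ hnull)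
    have hb := ae_all_iff.2 fun t : ℤ => (hsh t).quasiMeasurePreserving.ae (hsec _ hnull')
    filter_upwards [ha, hb] with w hwa hwb
    refine ⟨fun i => ?_, fun j => ?_⟩
    · by_contra hc
      push Not at hc
      refine hwa i (-c) ⟨rfl, fun k hk => hc (i + k) ?_⟩
      simpa [hrel] using hk
    · by_contra hc
      push Not at hc
      refine hwb j (-r (w j)) ⟨by simp, fun k hk => hc (j - k) ?_⟩
      have h1 := hDP _ hk
      rw [skewShift_zpow_apply] at h1 hk
      simp only [Set.mem_ofPred_eq] at h1
      rw [h1] at hk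
      simp only [hrel, sub_sub_cancel]
      convert hk using 3
      congr 1
      ring
  refine ⟨⟨fun w => permOfRel (rel w), ?_, ?_⟩, ?_⟩
  · intro w t k
    by_cases hw : w ∈ good
    · rw [happ _ ((hgs w t).2 hw), hshift, sub_add_cancel, ← happ w hw]
    · rw [hbad _ hw, hbad _ ((hgs w t).not.2 hw)]
      simp
  · intro k
    refine measurable_to_countable' fun l => ?_
    have : (fun w => permOfRel (rel w) k) ⁻¹' {l} =
        (good ∩ {w | rel w k l}) ∪ (goodᶜ ∩ {_w | k = l}) := by
      ext w
      by_cases hw : w ∈ good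
      · simp [hw, happ w hw]
      · simp [hw, hbad w hw]
    rw [this]
    exact (hgoodm.inter (hrm k l)).union (hgoodm.compl.inter (.const _))
  · filter_upwards [hae] with w hw
    have h := (happ w hw 0 _).1 rfl
    have hq := hDQ _ _ h
    rw [skewShift_zpow_apply] at hq
    simp only [Set.mem_ofPred_eq, sub_zero, add_zero, zero_add] at hq
    rw [neg_add_eq_sub, sub_add_eq_add_sub, sub_eq_zero] at hq
    exact hq

/-! ### Straightening the cocycle into a homomorphism -/

section
open FreeGroup

namespace FreeGroup

theorem eq_of_step {α V : Type*} [AddGroup V] {f f' : FreeGroup α → V} (h1 : f 1 = f' 1)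
    (h : ∀ k g, f (g * of k) - f g = f' (g * of k) - f' g) : f = f' := by
  ext g
  induction g using induction_right with
  | one => exact h1
  | mul_of g k ih =>
    have := h k g
    rw [ih] at this
    exact sub_left_injective this
  | mul_of_inv g k ih =>
    have := h k (g * (of k)⁻¹)
    rw [inv_mul_cancel_right, ih] at this
    exact sub_right_injective this

theorem walk_walk_inv {α Ω : Type*} (A : α → Equiv.Perm Ω) (o : Ω) (g : FreeGroup α) :
    walk A (walk A o g) g⁻¹ = o := by
  rw [← walk_mul, mul_inv_cancel, walk_one]

/-- The homomorphism to `ZMod n` that counts the occurrences of the letter `1`. -/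
def countHom (n : ℕ) : FreeGroup (Fin 2) →* Multiplicative (ZMod n) :=
  lift fun k => Multiplicative.ofAdd (if k = 1 then 1 else 0)

/-- The exponent sum of the letter `1`, modulo `n`. -/
def count (n : ℕ) (g : FreeGroup (Fin 2)) : ZMod n := (countHom n g).toAdd

@[simp] theorem count_one (n : ℕ) : count n 1 = 0 := by simp [count]

theorem count_mul (n : ℕ) (g h : FreeGroup (Fin 2)) :
    count n (g * h) = count n g + count n h := by simp [count]

theorem count_of (n : ℕ) (k : Fin 2) : count n (of k) = if k = 1 then 1 else 0 := by
  simp [count, countHom]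

theorem count_of_pow (n : ℕ) (m : ℕ) : count n (of 1 ^ m) = m := by
  simp [count, countHom]

end FreeGroup

section groupPotential
variable {W : Type*} {n : ℕ} (d : W → ZMod n) (x : FreeGroup (Fin 2) → W)

/-- The function on the free group that vanishes at `1`, is constant along the letter `1`, and
has the increment `d (x g)` from `g` to `g * of 0`. -/
def groupPotential (g : FreeGroup (Fin 2)) : ZMod n :=
  (walk (Ω := FreeGroup (Fin 2) × ZMod n) (fun k =>
    { toFun := fun p => (p.1 * of k, p.2 + if k = 0 then d (x p.1) else 0)
      invFun := fun p => (p.1 * (of k)⁻¹, p.2 - if k = 0 then d (x (p.1 * (of k)⁻¹)) else 0)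
      left_inv := fun p => by simp
      right_inv := fun p => by simp }) (1, 0) g).2

theorem groupPotential_one : groupPotential d x 1 = 0 := by simp [groupPotential]

theorem groupPotential_mul_of (g : FreeGroup (Fin 2)) (k : Fin 2) :
    groupPotential d x (g * of k) = groupPotential d x g + if k = 0 then d (x g) else 0 := by
  rw [groupPotential, walk_mul_of]
  simp only [Equiv.coe_fn_mk]
  rw [groupPotential]
  congr 3
  have : ∀ A : Fin 2 → Equiv.Perm (FreeGroup (Fin 2) × ZMod n),
      (∀ k p, (A k p).1 = p.1 * of k) → ∀ g, (walk A (1, 0) g).1 = g := by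
    intro A hA g
    induction g using induction_right with
    | one => simp
    | mul_of g k ih => rw [walk_mul_of, hA, ih]
    | mul_of_inv g k ih =>
      rw [walk_mul_of_inv, eq_mul_inv_iff_mul_eq, ← hA, Equiv.apply_symm_apply, ih]
  rw [this _ fun k p => rfl]

/-- On an a-line the cocycle on the tree is the one-dimensional `potential`; this links it to the
skew product. -/
theorem groupPotential_mul_zpow (g : FreeGroup (Fin 2)) (m : ℤ) :
    groupPotential d x (g * of 0 ^ m) =
      groupPotential d x g + potential d (lineAt 0 x g) m := by
  have h := potential_eq_of_step d
    (fun m => groupPotential d x (g * of 0 ^ m) - groupPotential d x g) (lineAt 0 x g)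
    (by simp) (fun m => by
      rw [zpow_add_one, ← mul_assoc, groupPotential_mul_of]
      simp only [if_true, lineAt]
      ring)
  rw [← h]
  simp

theorem eq_groupPotential {f : FreeGroup (Fin 2) → ZMod n} (h1 : f 1 = 0)
    (h : ∀ g k, f (g * of k) = f g + if k = 0 then d (x g) else 0) : f = groupPotential d x := by
  refine eq_of_step (h1.trans (groupPotential_one d x).symm) fun k g => ?_
  rw [h, groupPotential_mul_of]
  simp

theorem measurable_groupPotential [MeasurableSpace W] {d : W → ZMod n} (hd : Measurable d)
    [NeZero n] (g : FreeGroup (Fin 2)) : Measurable fun x => groupPotential d x g := by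
  have hm : ∀ g : FreeGroup (Fin 2), ∀ k : Fin 2,
      Measurable fun x : FreeGroup (Fin 2) → W => if k = 0 then d (x g) else 0 := by
    intro g k
    by_cases hk : k = 0
    · simp only [hk, if_true]; exact hd.comp (measurable_pi_apply g)
    · simp only [hk, if_false]; exact measurable_const
  induction g using induction_right with
  | one => simp only [groupPotential_one]; exact measurable_const
  | mul_of g k ih =>
    simp only [groupPotential_mul_of]
    exact ih.add (hm g k)
  | mul_of_inv g k ih =>
    have : ∀ x, groupPotential d x (g * (of k)⁻¹) =
        groupPotential d x g - if k = 0 then d (x (g * (of k)⁻¹)) else 0 := by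
      intro x
      rw [eq_sub_iff_add_eq, ← groupPotential_mul_of, inv_mul_cancel_right]
    simp only [this]
    exact ih.sub (hm _ k)

end groupPotential

theorem ae_lineAt {W : Type*} [MeasurableSpace W] (ω : Measure W) [IsProbabilityMeasure ω]
    (j : Fin 2) {p : (ℤ → W) → Prop} (hp : ∀ᵐ w ∂(Measure.infinitePi fun _ : ℤ => ω), p w) :
    ∀ᵐ x ∂(Measure.infinitePi fun _ : FreeGroup (Fin 2) => ω), ∀ g, p (lineAt j x g) := by
  refine ae_all_iff.2 fun g => ?_
  have hmp : MeasurePreserving (fun x : FreeGroup (Fin 2) → W => lineAt j x g)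
      (Measure.infinitePi fun _ : FreeGroup (Fin 2) => ω)
      (Measure.infinitePi fun _ : ℤ => ω) :=
    ⟨measurable_lineAt j g, Measure.map_infinitePi_infinitePi_of_inj
      ((mul_right_injective g).comp (of_zpow_injective j))⟩
  exact hmp.quasiMeasurePreserving.ae hp

/-- Two slides transform the cocycle with the uniformly distributed increment `d` along the
letter `0` into the homomorphism that counts the letter `1`. -/
theorem exists_equiv_straightening {W : Type*} [MeasurableSpace W] (ω : Measure W)
    [IsProbabilityMeasure ω] {n : ℕ} [NeZero n] {d : W → ZMod n} (hd : Measurable d)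
    (hunif : ∀ κ, ω (d ⁻¹' {κ}) = (n : ENNReal)⁻¹) :
    ∃ Ψ : (FreeGroup (Fin 2) → W) ≃ᵐ (FreeGroup (Fin 2) → W),
      MeasurePreserving Ψ (Measure.infinitePi fun _ => ω) (Measure.infinitePi fun _ => ω) ∧
      ∀ᵐ x ∂(Measure.infinitePi fun _ => ω), ∃ θ : FreeGroup (Fin 2) → FreeGroup (Fin 2),
        Function.Surjective θ ∧ ∀ k, (Ψ fun h => x (θ k * h)) = (fun h => Ψ x (k * h)) ∧
          groupPotential d x (θ k) = count n k := by
  -- Move along an a-line until the sum of d is 1; the b-edge that follows contributes 0, whence r =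
  -- 0 and c = 1.
  obtain ⟨π₁, h₁⟩ := exists_linePerm ω hd (measurable_const (a := (0 : ZMod n))) 1
    fun B hB hinv => skewShift_ergodic ω hd
      (fun R C hC hR => skewShift_mixing_of_uniform ω hd hunif R C hC hR) hB hinv
  -- After the first slide every b-step counts 1, so moving along a b-line can cancel the increment
  -- d of the a-edge at its end: s = 1, r = d, c = 0.
  obtain ⟨π₂, h₂⟩ := exists_linePerm ω (measurable_const (a := (1 : ZMod n))) hd 0
    fun B hB hinv => skewShift_ergodic ω measurable_const
      (fun R C hC hR => skewShift_mixing_of_one ω R C hC hR) hB hinv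
  have h01 : (0 : Fin 2) ≠ 1 := by decide
  have h10 : (1 : Fin 2) ≠ 0 := by decide
  have mp₁ := π₁.measurePreserving_slide ω h01
  have mp₂ := π₂.measurePreserving_slide ω h10
  refine ⟨(π₁.slideEquiv h01).trans (π₂.slideEquiv h10), mp₂.comp mp₁, ?_⟩
  filter_upwards [ae_lineAt ω 0 h₁, mp₁.quasiMeasurePreserving.ae (ae_lineAt ω 1 h₂)] with x hx hy
  set y := π₁.slide 1 0 x with hydef
  set θ₁ := π₁.pos 1 0 x with hθ₁
  set θ₂ := π₂.pos 0 1 y with hθ₂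
  have hsurj : ∀ (π : LinePerm W) (i j : Fin 2) (x : FreeGroup (Fin 2) → W), j ≠ i →
      Function.Surjective (π.pos i j x) := fun π i j x hij g =>
    ⟨_, π.pos_pos_symm x hij g⟩
  refine ⟨θ₁ ∘ θ₂, (hsurj _ _ _ _ h01).comp (hsurj _ _ _ _ h10), fun k => ⟨?_, ?_⟩⟩
  · change π₂.slide 0 1 (π₁.slide 1 0 fun h => x (θ₁ (θ₂ k) * h)) = fun h => π₂.slide 0 1 y (k * h)
    rw [hθ₁, π₁.slide_translate, ← π₂.slide_translate]
  · have q1 : ∀ h k, groupPotential d x (θ₁ (h * of k)) =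
        groupPotential d x (θ₁ h) + if k = 0 then d (y h) else 1 := by
      intro h k
      fin_cases k
      · rw [hθ₁]
        simp only [Fin.zero_eta, if_true]
        rw [π₁.pos_mul_of_ne x h01, groupPotential_mul_of, if_pos rfl]
        rfl
      · rw [hθ₁]
        simp only [Fin.mk_one, if_neg h10]
        rw [π₁.pos_mul_of, LinePerm.slideEdge_apply, groupPotential_mul_of, if_neg h10, add_zero,
          groupPotential_mul_zpow]
        have := hx (π₁.pos 1 0 x h)
        rw [add_zero] at this
        rw [this]
    have q1line : ∀ h (m : ℤ), groupPotential d x (θ₁ (h * of 1 ^ m)) =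
        groupPotential d x (θ₁ h) + potential (fun _ : W => (1 : ZMod n)) (lineAt 1 y h) m := by
      intro h m
      have e := potential_eq_of_step (fun _ : W => (1 : ZMod n))
        (fun m => groupPotential d x (θ₁ (h * of 1 ^ m)) - groupPotential d x (θ₁ h))
        (lineAt 1 y h) (by simp) (fun m => by
          rw [zpow_add_one, ← mul_assoc, q1, if_neg h10]
          ring)
      rw [← e]
      simp
    have q2 : (fun k => groupPotential d x (θ₁ (θ₂ k))) = count n := by
      refine eq_of_step ?_ fun k g => ?_
      · simp [hθ₁, hθ₂, groupPotential_one]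
      · rw [count_mul, count_of, add_sub_cancel_left]
        fin_cases k
        · simp only [Fin.zero_eta, if_neg h01]
          rw [hθ₂, π₂.pos_mul_of, LinePerm.slideEdge_apply, q1, if_pos rfl, q1line, add_assoc,
            add_sub_cancel_left]
          exact hy (π₂.pos 0 1 y g)
        · simp only [Fin.mk_one, if_true]
          rw [hθ₂, π₂.pos_mul_of_ne y h10, q1, if_neg h10, add_sub_cancel_left]
    exact congrFun q2 k

end

/-! ### The kernel of the counting homomorphism, and uniform product measures -/

section
open FreeGroup

section kernel
variable (m : ℕ)

/-- The free generators `b ^ (m + 1)` and `b ^ k * a * b ^ (-k)`, for `k ≤ m`, of the kernel of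
`count (m + 1)`, as a homomorphism. -/
def kernelHom : FreeGroup (Fin (m + 1 + 1)) →* FreeGroup (Fin 2) :=
  lift (Fin.cons (of 1 ^ (m + 1)) fun k : Fin (m + 1) => of 1 ^ (k : ℕ) * of 0 * (of 1 ^ (k : ℕ))⁻¹)

theorem kernelHom_of_zero : kernelHom m (of 0) = of 1 ^ (m + 1) := by simp [kernelHom]

theorem kernelHom_of_succ (k : Fin (m + 1)) :
    kernelHom m (of k.succ) = of 1 ^ (k : ℕ) * of 0 * (of 1 ^ (k : ℕ))⁻¹ := by simp [kernelHom]

/-- The element `h * b ^ k` of the free group, for `h` in the kernel of `count (m + 1)`. -/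
def kernelCoset (p : FreeGroup (Fin (m + 1 + 1)) × Fin (m + 1)) : FreeGroup (Fin 2) :=
  kernelHom m p.1 * of 1 ^ (p.2 : ℕ)

/-- Right multiplication by the letters, in terms of `kernelCoset`. -/
def kernelStep (k : Fin 2) : Equiv.Perm (FreeGroup (Fin (m + 1 + 1)) × Fin (m + 1)) :=
  if k = 0 then
    { toFun := fun p => (p.1 * of p.2.succ, p.2)
      invFun := fun p => (p.1 * (of p.2.succ)⁻¹, p.2)
      left_inv := fun p => by simp
      right_inv := fun p => by simp }
  else
    { toFun := fun p => (p.1 * if p.2 = Fin.last m then of 0 else 1, p.2 + 1)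
      invFun := fun p => (p.1 * (if p.2 - 1 = Fin.last m then of 0 else 1)⁻¹, p.2 - 1)
      left_inv := fun p => by
        dsimp only; rw [add_sub_cancel_right, mul_inv_cancel_right]
      right_inv := fun p => by
        dsimp only; rw [sub_add_cancel, inv_mul_cancel_right] }

theorem kernelStep_zero (p : FreeGroup (Fin (m + 1 + 1)) × Fin (m + 1)) :
    kernelStep m 0 p = (p.1 * of p.2.succ, p.2) := rfl

theorem kernelStep_one (p : FreeGroup (Fin (m + 1 + 1)) × Fin (m + 1)) :
    kernelStep m 1 p = (p.1 * if p.2 = Fin.last m then of 0 else 1, p.2 + 1) := rfl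

/-- A letter a after b^k is (b^k a b^(-k)) b^k, hence a generator of the kernel in front of the same
coset representative. A letter b only advances the representative, except from the last coset, where
it completes b^(m+1). -/
theorem kernelCoset_step (k : Fin 2) (p : FreeGroup (Fin (m + 1 + 1)) × Fin (m + 1)) :
    kernelCoset m (kernelStep m k p) = kernelCoset m p * of k := by
  obtain ⟨h, l⟩ := p
  have hk : k = 0 ∨ k = 1 := by omega
  rcases hk with rfl | rfl
  · simp only [kernelStep_zero, kernelCoset, _root_.map_mul, kernelHom_of_succ]
    group
  · simp only [kernelStep_one, kernelCoset, _root_.map_mul, Fin.val_add_one]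
    split_ifs with hl
    · rw [hl, kernelHom_of_zero, Fin.val_last, pow_succ, pow_zero, mul_one, mul_assoc]
    · rw [_root_.map_one, mul_one, pow_succ, mul_assoc]

theorem kernelCoset_walk (g : FreeGroup (Fin 2)) :
    kernelCoset m (walk (kernelStep m) (1, 0) g) = g := by
  induction g using induction_right with
  | one => simp [kernelCoset]
  | mul_of g k ih => rw [walk_mul_of, kernelCoset_step, ih]
  | mul_of_inv g k ih =>
    rw [walk_mul_of_inv, eq_mul_inv_iff_mul_eq, ← kernelCoset_step, Equiv.apply_symm_apply, ih]

theorem walk_kernelStep_pow (h : FreeGroup (Fin (m + 1 + 1))) (k : Fin (m + 1)) :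
    walk (kernelStep m) (h, 0) (of 1 ^ (k : ℕ)) = (h, k) := by
  induction k using Fin.induction with
  | zero => simp
  | succ k ih =>
    rw [Fin.val_castSucc] at ih
    rw [Fin.val_succ, pow_succ, walk_mul_of, ih, kernelStep_one]
    simp only [if_neg (Fin.castSucc_lt_last k).ne, mul_one, Fin.coeSucc_eq_succ]

theorem walk_kernelHom_of (h : FreeGroup (Fin (m + 1 + 1))) (l : Fin (m + 1 + 1)) :
    walk (kernelStep m) (h, 0) (kernelHom m (of l)) = (h * of l, 0) := by
  induction l using Fin.cases with
  | zero =>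
    have := walk_kernelStep_pow m h (Fin.last m)
    rw [Fin.val_last] at this
    rw [kernelHom_of_zero, pow_succ, walk_mul_of, this, kernelStep_one]
    simp
  | succ k =>
    rw [kernelHom_of_succ, walk_mul, walk_mul_of, walk_kernelStep_pow, kernelStep_zero,
      ← walk_kernelStep_pow, walk_walk_inv]

/-- The walk recovers h from its image, so `kernelHom` is injective: the listed generators are free.
-/
theorem walk_kernelHom (h : FreeGroup (Fin (m + 1 + 1))) :
    walk (kernelStep m) (1, 0) (kernelHom m h) = (h, 0) := by
  induction h using induction_right with
  | one => simp
  | mul_of h l ih => rw [_root_.map_mul, walk_mul, ih, walk_kernelHom_of]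
  | mul_of_inv h l ih =>
    have := walk_kernelHom_of m (h * (of l)⁻¹) l
    rw [inv_mul_cancel_right] at this
    rw [_root_.map_mul, walk_mul, ih, ← this, _root_.map_inv, walk_walk_inv]

/-- The decomposition of the free group into cosets of the kernel of `count (m + 1)`. -/
def kernelEquiv : FreeGroup (Fin (m + 1 + 1)) × Fin (m + 1) ≃ FreeGroup (Fin 2) where
  toFun := kernelCoset m
  invFun := walk (kernelStep m) (1, 0)
  left_inv := fun ⟨h, k⟩ => by
    rw [kernelCoset, walk_mul, walk_kernelHom, walk_kernelStep_pow]
  right_inv := kernelCoset_walk m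

theorem count_kernelHom (h : FreeGroup (Fin (m + 1 + 1))) :
    FreeGroup.count (m + 1) (kernelHom m h) = 0 := by
  have : (countHom (m + 1)).comp (kernelHom m) = 1 := by
    ext l
    induction l using Fin.cases with
    | zero =>
      simp only [MonoidHom.comp_apply, kernelHom_of_zero, MonoidHom.one_apply]
      have := count_of_pow (m + 1) (m + 1)
      rw [ZMod.natCast_self] at this
      exact this
    | succ k =>
      simp [kernelHom_of_succ, countHom]
  exact congrArg Multiplicative.toAdd (DFunLike.congr_fun this h)

theorem exists_kernelHom_eq {g : FreeGroup (Fin 2)} (hg : FreeGroup.count (m + 1) g = 0) :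
    ∃ h, kernelHom m h = g := by
  obtain ⟨⟨h, k⟩, rfl⟩ := (kernelEquiv m).surjective g
  change FreeGroup.count (m + 1) (kernelHom m h * of 1 ^ (k : ℕ)) = 0 at hg
  rw [count_mul, count_kernelHom, zero_add, count_of_pow, ZMod.natCast_eq_zero_iff] at hg
  have hk : (k : ℕ) = 0 := Nat.eq_zero_of_dvd_of_lt hg k.2
  exact ⟨h, by simp [kernelEquiv, kernelCoset, hk]⟩

variable {W : Type*} [MeasurableSpace W]

/-- Labellings of the free group of rank two as labellings of the kernel of `count (m + 1)`. -/
def kernelLabel :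
    (FreeGroup (Fin 2) → W) ≃ᵐ (FreeGroup (Fin (m + 1 + 1)) → Fin (m + 1) → W) where
  toFun x h k := x (kernelEquiv m (h, k))
  invFun y g := y ((kernelEquiv m).symm g).1 ((kernelEquiv m).symm g).2
  left_inv x := by ext g; simp
  right_inv y := by ext h k; simp
  measurable_toFun := measurable_pi_lambda _ fun h => measurable_pi_lambda _ fun k =>
    measurable_pi_apply _
  measurable_invFun := measurable_pi_lambda _ fun g =>
    (by fun_prop : Measurable fun y : FreeGroup (Fin (m + 1 + 1)) → Fin (m + 1) → W =>
      y ((kernelEquiv m).symm g).1 ((kernelEquiv m).symm g).2)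

/-- Left translation by the kernel leaves the representative b^k alone, so the restricted action is
a shift whose base consists of one label for each coset. -/
theorem kernelLabel_translate (x : FreeGroup (Fin 2) → W) (h' : FreeGroup (Fin (m + 1 + 1))) :
    kernelLabel m (fun g => x (kernelHom m h' * g)) = fun h => kernelLabel m x (h' * h) := by
  ext h k
  simp [kernelLabel, kernelEquiv, kernelCoset, mul_assoc]

theorem measurePreserving_kernelLabel (ω : Measure W) [IsProbabilityMeasure ω] :
    MeasurePreserving (kernelLabel m) (Measure.infinitePi fun _ : FreeGroup (Fin 2) => ω)
      (Measure.infinitePi fun _ : FreeGroup (Fin (m + 1 + 1)) =>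
        Measure.infinitePi fun _ : Fin (m + 1) => ω) := by
  refine ⟨(kernelLabel m).measurable, ?_⟩
  have h1 := Measure.map_infinitePi_infinitePi_of_inj (P := fun _ : FreeGroup (Fin 2) => ω)
    (kernelEquiv m).injective
  have h2 := Measure.infinitePi_map_curry
    (fun (_ : FreeGroup (Fin (m + 1 + 1))) (_ : Fin (m + 1)) => ω)
  rw [← h2, ← h1, Measure.map_map (MeasurableEquiv.measurable _) (by fun_prop)]
  rfl

end kernel

section uniform

/-- A probability measure on a power of a finite group that is invariant under the translation
of single coordinates is the product of uniform measures. -/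
theorem eq_infinitePi_of_translate_single {I V : Type*} [DecidableEq I] [AddCommGroup V]
    [Fintype V] [MeasurableSpace V] [DiscreteMeasurableSpace V] (ω : Measure V)
    [IsProbabilityMeasure ω] (hω : ∀ v, ω {v} = (Fintype.card V : ENNReal)⁻¹)
    (Q : Measure (I → V)) [IsProbabilityMeasure Q]
    (hQ : ∀ i v, Q.map (fun x => x + Pi.single i v) = Q) :
    Q = Measure.infinitePi fun _ => ω := by
  have hmeas : ∀ (i : I) (v : V), Measurable fun x : I → V => x + Pi.single i v := by
    intro i v
    refine measurable_pi_lambda _ fun j => ?_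
    exact (Measurable.of_discrete (f := fun w : V => w + (Pi.single i v : I → V) j)).comp
      (by fun_prop : Measurable fun x : I → V => x j)
  refine Measure.eq_infinitePi _ fun s t ht => ?_
  induction s using Finset.induction_on with
  | empty => simp
  | insert i s hi ih =>
    have hE : MeasurableSet (Set.pi (s : Set I) t) := .pi (Finset.countable_toSet _) fun _ _ => ht _
    have hm : ∀ v, MeasurableSet {x : I → V | x i = v} := fun v =>
      (by fun_prop : Measurable fun x : I → V => x i) (measurableSet_singleton v)
    -- Translating coordinate i does not affect the event on s and carries the fibre over 0 to the
    -- fibre over v, so all fibres have equal mass.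
    have hconst : ∀ v, Q (Set.pi s t ∩ {x | x i = v}) = Q (Set.pi s t ∩ {x | x i = 0}) := by
      intro v
      conv_lhs => rw [← hQ i v, Measure.map_apply (hmeas i v) (hE.inter (hm v))]
      congr 1
      ext x
      simp only [Set.mem_preimage, Set.mem_inter_iff, Set.mem_pi, Finset.mem_coe, Pi.add_apply,
        Set.mem_ofPred_eq, Pi.single_eq_same, add_eq_right]
      refine and_congr_left fun _ => forall₂_congr fun j hj => ?_
      rw [Pi.single_eq_of_ne (by rintro rfl; exact hi hj), add_zero]
    have hfib : ∀ v, Q (Set.pi s t ∩ {x | x i = v}) = ω {v} * Q (Set.pi s t) := by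
      intro v
      rw [measure_eq_sum_fiber Q (Set.pi s t) (measurable_pi_apply i),
        Finset.sum_congr rfl fun v _ => hconst v, hconst v, hω]
      simp only [Finset.sum_const, Finset.card_univ, nsmul_eq_mul]
      rw [← mul_assoc, ENNReal.inv_mul_cancel (by simp) (by simp), one_mul]
    have hsplit : Q (Set.pi (insert i s : Finset I) t) =
        ∑ v, Q (Set.pi s t ∩ {x | x i = v}) * (t i).indicator 1 v := by
      rw [measure_eq_sum_fiber Q _ (measurable_pi_apply i)]
      refine Finset.sum_congr rfl fun v _ => ?_
      by_cases hv : v ∈ t i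
      · rw [Set.indicator_of_mem hv, Pi.one_apply, mul_one]
        congr 1
        ext x
        simp only [Finset.coe_insert, Set.insert_pi, Set.mem_inter_iff, Set.mem_preimage,
          Function.eval, Set.mem_ofPred_eq]
        exact ⟨fun h => ⟨h.1.2, h.2⟩, fun h => ⟨⟨by rw [h.2]; exact hv, h.1⟩, h.2⟩⟩
      · rw [Set.indicator_of_notMem hv, mul_zero]
        refine measure_mono_null (t := ∅) ?_ measure_empty
        rintro x ⟨h1, h2⟩
        exact hv (h2 ▸ h1 i (by simp))
    rw [hsplit, Finset.prod_insert hi, ← ih]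
    simp_rw [hfib]
    have hti : ω (t i) = ∑ v, ω {v} * (t i).indicator 1 v := by
      rw [measure_eq_sum_fiber ω (t i) measurable_id]
      refine Finset.sum_congr rfl fun v _ => ?_
      by_cases hv : v ∈ t i
      · rw [Set.indicator_of_mem hv, Pi.one_apply, mul_one]
        congr 1
        ext u
        simp only [id, Set.mem_inter_iff, Set.mem_ofPred_eq, Set.mem_singleton_iff,
          and_iff_right_iff_imp]
        rintro rfl; exact hv
      · rw [Set.indicator_of_notMem hv, mul_zero]
        refine measure_mono_null (t := ∅) ?_ measure_empty
        rintro u ⟨h1, h2⟩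
        exact hv (h2 ▸ h1)
    rw [hti, Finset.sum_mul]
    exact Finset.sum_congr rfl fun v _ => by rw [mul_right_comm]

end uniform

end

/-! ### Increments of labellings that are constant on cosets of ⟨b⟩ -/

section
open FreeGroup

section coset
variable {K : Type*} {n : ℕ} (e : K ≃ ZMod n)

/-- The labellings in the image of `cosetEmbedding` with first label `0` at `1`. -/
def cosetBase : Set (FreeGroup (Fin 2) → K × K) :=
  {z | e (z 1).1 = 0 ∧ ∀ g, (z (g * of 1)).1 = (z g).1}

/-- The increments of the first label along the letter `0`, together with the second label. -/
def cosetIncrement (z : FreeGroup (Fin 2) → K × K) (g : FreeGroup (Fin 2)) : ZMod n × ZMod n :=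
  (e (z (g * of 0)).1 - e (z g).1, e (z g).2)

theorem groupPotential_cosetIncrement {z : FreeGroup (Fin 2) → K × K} (hz : z ∈ cosetBase e)
    (g : FreeGroup (Fin 2)) : groupPotential Prod.fst (cosetIncrement e z) g = e (z g).1 := by
  refine (congrFun (eq_groupPotential (f := fun g => e (z g).1) _ _ hz.1 fun g k => ?_) g).symm
  fin_cases k
  · simp [cosetIncrement]
  · simp [hz.2]

theorem cosetIncrement_translate (z : FreeGroup (Fin 2) → K × K) (k : FreeGroup (Fin 2)) :
    cosetIncrement e (fun h => z (k * h)) = fun h => cosetIncrement e z (k * h) := by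
  ext h <;> simp [cosetIncrement, mul_assoc]

/-- Constancy along b survives translation, so only the first label at k matters, and it is the sum
of the increments from 1 to k. -/
theorem translate_mem_cosetBase_iff {z : FreeGroup (Fin 2) → K × K} (hz : z ∈ cosetBase e)
    (k : FreeGroup (Fin 2)) : (fun h => z (k * h)) ∈ cosetBase e ↔
      groupPotential Prod.fst (cosetIncrement e z) k = 0 := by
  rw [groupPotential_cosetIncrement e hz, cosetBase, Set.mem_ofPred_eq]
  refine (and_iff_left fun g => ?_).trans (by beta_reduce; rw [mul_one])
  beta_reduce
  rw [← mul_assoc, hz.2]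

theorem cosetEmbedding_preimage_cosetBase :
    cosetEmbedding K ⁻¹' cosetBase e = {p | e (p.1 ((1 : FreeGroup (Fin 2)) :)) = 0} := by
  ext p
  simp only [cosetBase, Set.mem_preimage, Set.mem_ofPred_eq, cosetEmbedding, and_iff_left_iff_imp]
  intro _ g
  exact congrArg p.1 (QuotientGroup.mk_mul_of_mem g (Subgroup.mem_zpowers _))

variable [NeZero n] [MeasurableSpace K] [DiscreteMeasurableSpace K]

theorem measurable_cosetIncrement : Measurable (cosetIncrement e) := by
  have he : Measurable e := .of_discrete
  refine measurable_pi_lambda _ fun g => Measurable.prodMk (Measurable.sub ?_ ?_) ?_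
  · exact he.comp (measurable_fst.comp (measurable_pi_apply (g * of 0)))
  · exact he.comp (measurable_fst.comp (measurable_pi_apply g))
  · exact he.comp (measurable_snd.comp (measurable_pi_apply g))

theorem measurableSet_cosetBase : MeasurableSet (cosetBase e) := by
  have he : Measurable e := .of_discrete
  have hz : ∀ g : FreeGroup (Fin 2), Measurable fun z : FreeGroup (Fin 2) → K × K => e (z g).1 :=
    fun g => he.comp (measurable_fst.comp (measurable_pi_apply g))
  have : cosetBase e = {z | e (z 1).1 = 0} ∩ ⋂ g, {z | e (z (g * of 1)).1 = e (z g).1} := by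
    ext z; simp [cosetBase]
  rw [this]
  exact (hz 1 (measurableSet_singleton 0)).inter
    (.iInter fun g => measurableSet_eq_fun (hz _) (hz _))

/-- The labellings with first label `0` at `1` are determined by their increments. -/
def cosetBaseEquiv : cosetBase e ≃ᵐ (FreeGroup (Fin 2) → ZMod n × ZMod n) where
  toFun z := cosetIncrement e z
  invFun x := ⟨fun g => (e.symm (groupPotential Prod.fst x g), e.symm (x g).2), by
    refine ⟨by simp [groupPotential_one], fun g => ?_⟩
    simp [groupPotential_mul_of]⟩
  left_inv z := by
    ext g
    · simp [groupPotential_cosetIncrement e z.2]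
    · simp [cosetIncrement]
  right_inv x := by
    ext g <;> simp [cosetIncrement, groupPotential_mul_of]
  measurable_toFun := (measurable_cosetIncrement e).comp measurable_subtype_coe
  measurable_invFun := by
    have he : Measurable e.symm := .of_discrete
    refine Measurable.subtype_mk (measurable_pi_lambda _ fun g => Measurable.prodMk ?_ ?_)
    · exact he.comp (measurable_groupPotential measurable_fst g)
    · exact he.comp (measurable_snd.comp (measurable_pi_apply g))

theorem cosetBaseEquiv_apply (z : cosetBase e) : cosetBaseEquiv e z = cosetIncrement e z := rfl

variable (κ : Measure K) [IsProbabilityMeasure κ]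

theorem cosetMeasure_cosetBase (hκ : ∀ v, κ {v} = (n : ENNReal)⁻¹) :
    cosetMeasure κ (cosetBase e) = (n : ENNReal)⁻¹ := by
  rw [cosetMeasure, Measure.map_apply (measurable_cosetEmbedding K) (measurableSet_cosetBase e),
    cosetEmbedding_preimage_cosetBase, ← hκ (e.symm 0)]
  have h : {p : (FreeGroup (Fin 2) ⧸ subgroupB → K) × (FreeGroup (Fin 2) → K) |
      e (p.1 ((1 : FreeGroup (Fin 2)) :)) = 0} =
        ((fun x : FreeGroup (Fin 2) ⧸ subgroupB → K => x ((1 : FreeGroup (Fin 2)) :)) ⁻¹'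
          {e.symm 0}) ×ˢ Set.univ := by
    ext p
    simp [Equiv.eq_symm_apply]
  rw [h, Measure.prod_prod, measure_univ, mul_one,
    (measurePreserving_eval_infinitePi (fun _ : FreeGroup (Fin 2) ⧸ subgroupB => κ)
      ((1 : FreeGroup (Fin 2)) :)).measure_preimage (measurableSet_singleton _).nullMeasurableSet]

theorem measurePreserving_perm_infinitePi [Countable K] (hκ : ∀ v v', κ {v} = κ {v'}) {I : Type*}
    (σ : I → Equiv.Perm K) : MeasurePreserving (fun (x : I → K) i => σ i (x i))
      (Measure.infinitePi fun _ => κ) (Measure.infinitePi fun _ => κ) := by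
  have hσ : ∀ i, Measurable (σ i) := fun i => .of_discrete
  refine ⟨by fun_prop, ?_⟩
  rw [Measure.infinitePi_map_pi _ hσ]
  congr 1
  ext1 i
  refine Measure.ext_of_singleton fun v => ?_
  rw [Measure.map_apply (hσ i) (measurableSet_singleton v)]
  have : σ i ⁻¹' {v} = {(σ i).symm v} := by ext; simp [Equiv.eq_symm_apply]
  rw [this]
  exact hκ _ _

/-- The increments of a random labelling with first label `0` at `1` are independent. -/
theorem map_cosetIncrement_cond (hκ : ∀ v, κ {v} = (n : ENNReal)⁻¹)
    (ω : Measure (ZMod n × ZMod n)) [IsProbabilityMeasure ω]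
    (hω : ∀ v, ω {v} = (Fintype.card (ZMod n × ZMod n) : ENNReal)⁻¹) :
    (ProbabilityTheory.cond (cosetMeasure κ) (cosetBase e)).map (cosetIncrement e) =
      Measure.infinitePi fun _ => ω := by
  have hA := measurableSet_cosetBase e
  have hD := measurable_cosetIncrement e
  have hcard := cosetMeasure_cosetBase e κ hκ
  have : IsProbabilityMeasure (ProbabilityTheory.cond (cosetMeasure κ) (cosetBase e)) :=
    cond_isProbabilityMeasure (by rw [hcard]; simp)
  have := Measure.isProbabilityMeasure_map (μ := ProbabilityTheory.cond (cosetMeasure κ)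
    (cosetBase e)) hD.aemeasurable
  have : Countable K := e.countable_iff.2 inferInstance
  refine eq_infinitePi_of_translate_single ω hω _ fun g c => ?_
  have hT : Measurable fun x : FreeGroup (Fin 2) → ZMod n × ZMod n => x + Pi.single g c := by
    refine measurable_pi_lambda _ fun h => ?_
    exact (Measurable.of_discrete (f := fun w : ZMod n × ZMod n =>
      w + (Pi.single g c : FreeGroup (Fin 2) → ZMod n × ZMod n) h)).comp
      (by fun_prop : Measurable fun x : FreeGroup (Fin 2) → ZMod n × ZMod n => x h)
  classical
  -- The increment of u is c.1 across the edge from g to ga and 0 across all other edges: a multiple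
  -- of the indicator of the far side of that edge. The subtracted constant gives u(1) = 0, so
  -- adding u preserves the base set.
  set u : FreeGroup (Fin 2) → ZMod n := fun h =>
    (if g⁻¹ * h ∈ branch 0 then c.1 else 0) - if g⁻¹ ∈ branch 0 then c.1 else 0 with hu
  have hu1 : u 1 = 0 := by simp [hu]
  have hub : ∀ h (m : ℤ), u (h * of 1 ^ m) = u h := by
    intro h m
    simp only [hu, ← mul_assoc]
    rw [mul_zpow_mem_branch_of_ne (by decide)]
  have hua : ∀ h, u (h * of 0) - u h = if h = g then c.1 else 0 := by
    intro h
    simp only [hu, sub_sub_sub_cancel_right, ← mul_assoc]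
    by_cases hh : h = g
    · subst hh
      simp [of_mem_branch, one_notMem_branch]
    · have h1 : g⁻¹ * h ≠ 1 := fun h1 => hh (inv_mul_eq_one.1 h1).symm
      simp only [mul_of_mem_branch h1, sub_self, if_neg hh]
  have hout : ∀ h : FreeGroup (Fin 2), u (h : FreeGroup (Fin 2) ⧸ subgroupB).out = u h := by
    intro h
    obtain ⟨⟨b, hb⟩, h1⟩ := QuotientGroup.mk_out_eq_mul subgroupB h
    obtain ⟨m, rfl⟩ := Subgroup.mem_zpowers_iff.1 hb
    rw [h1]
    exact hub h m
  -- Coordinatewise translations preserve the uniform measures; this one changes the increments only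
  -- at g, and there by c.
  set τ : (FreeGroup (Fin 2) ⧸ subgroupB → K) × (FreeGroup (Fin 2) → K) →
      (FreeGroup (Fin 2) ⧸ subgroupB → K) × (FreeGroup (Fin 2) → K) :=
    Prod.map (fun p q => (e.trans ((Equiv.addRight (u q.out)).trans e.symm)) (p q))
      (fun y h => (e.trans ((Equiv.addRight
        ((Pi.single g c.2 : FreeGroup (Fin 2) → ZMod n) h)).trans e.symm)) (y h)) with hτ
  have hmp := (measurePreserving_perm_infinitePi κ (fun v v' => (hκ v).trans (hκ v').symm)
      fun q : FreeGroup (Fin 2) ⧸ subgroupB =>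
        (e.trans ((Equiv.addRight (u q.out)).trans e.symm))).prod
    (measurePreserving_perm_infinitePi κ (fun v v' => (hκ v).trans (hκ v').symm)
      fun h : FreeGroup (Fin 2) => (e.trans ((Equiv.addRight
        ((Pi.single g c.2 : FreeGroup (Fin 2) → ZMod n) h)).trans e.symm)))
  have hcomm : ∀ p, cosetIncrement e (cosetEmbedding K (τ p)) =
      cosetIncrement e (cosetEmbedding K p) + Pi.single g c := by
    intro p
    ext h
    · simp only [hτ, cosetIncrement, cosetEmbedding, Prod.map, Equiv.trans_apply,
        Equiv.coe_addRight, Equiv.apply_symm_apply, hout, Pi.add_apply, Prod.fst_add]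
      rw [add_sub_add_comm, hua]
      congr 1
      by_cases hh : h = g
      · subst hh; simp
      · simp [hh]
    · simp only [hτ, cosetIncrement, cosetEmbedding, Prod.map, Equiv.trans_apply,
        Equiv.coe_addRight, Equiv.apply_symm_apply, Pi.add_apply, Prod.snd_add]
      congr 1
      by_cases hh : h = g
      · subst hh; simp
      · simp [hh]
  have hbase : ∀ p, cosetEmbedding K (τ p) ∈ cosetBase e ↔ cosetEmbedding K p ∈ cosetBase e := by
    intro p
    have h : ∀ q, cosetEmbedding K q ∈ cosetBase e ↔ e (q.1 ((1 : FreeGroup (Fin 2)) :)) = 0 :=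
      Set.ext_iff.1 (cosetEmbedding_preimage_cosetBase e)
    rw [h, h]
    simp [hτ, hout, hu1]
  ext E hE
  rw [Measure.map_map hT hD, Measure.map_apply (hT.comp hD) hE, Measure.map_apply hD hE,
    cond_apply hA, cond_apply hA]
  congr 1
  have hm1 := hA.inter ((hT.comp hD) hE)
  have hm2 := hA.inter (hD hE)
  rw [cosetMeasure, Measure.map_apply (measurable_cosetEmbedding K) hm1,
    Measure.map_apply (measurable_cosetEmbedding K) hm2]
  rw [← hmp.measure_preimage ((measurable_cosetEmbedding K) hm2).nullMeasurableSet]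
  congr 1
  ext p
  have h1 := hcomm p
  have h2 := hbase p
  simp only [Set.mem_preimage, Set.mem_inter_iff, Function.comp_apply]
  rw [← h1, ← h2]

end coset

end

/-! ### Assembling the stable orbit equivalence -/

theorem PMF.uniformOfFintype_toMeasure_singleton {W : Type*} [Fintype W] [Nonempty W]
    [MeasurableSpace W] [MeasurableSingletonClass W] (v : W) :
    (PMF.uniformOfFintype W).toMeasure {v} = (Fintype.card W : ENNReal)⁻¹ := by
  rw [PMF.toMeasure_apply_singleton _ _ (measurableSet_singleton v), PMF.uniformOfFintype_apply]

theorem uniform_preimage_fst_singleton {n : ℕ} [NeZero n] (κ : ZMod n) :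
    (PMF.uniformOfFintype (ZMod n × ZMod n)).toMeasure (Prod.fst ⁻¹' {κ}) = (n : ENNReal)⁻¹ := by
  classical
  rw [PMF.toMeasure_uniformOfFintype_apply _ (measurable_fst (measurableSet_singleton κ)),
    Fintype.card_congr (show ↥(Prod.fst ⁻¹' {κ} : Set (ZMod n × ZMod n)) ≃ ZMod n from
      { toFun := fun p => p.1.2
        invFun := fun c => ⟨(κ, c), rfl⟩
        left_inv := by rintro ⟨⟨a, c⟩, rfl⟩; rfl
        right_inv := fun c => rfl }), Fintype.card_prod, ZMod.card, Nat.cast_mul,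
    ENNReal.div_eq_inv_mul, ENNReal.mul_inv (by simp) (by simp), mul_assoc,
    ENNReal.inv_mul_cancel (by simp [NeZero.ne n]) (by simp), mul_one]

theorem infinitePi_uniform_singleton_ne_one {W : Type*} [Fintype W] [Nontrivial W]
    [MeasurableSpace W] [MeasurableSingletonClass W] (m : ℕ) (l : Fin (m + 1) → W) :
    Measure.infinitePi (fun _ : Fin (m + 1) => (PMF.uniformOfFintype W).toMeasure) {l} ≠ 1 := by
  have h : ((Fintype.card W : ENNReal)⁻¹) ^ (m + 1) < 1 := by
    refine pow_lt_one' ?_ (Nat.succ_ne_zero m)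
    rw [ENNReal.inv_lt_one]
    exact_mod_cast Fintype.one_lt_card
  rw [Measure.infinitePi_eq_pi, Measure.pi_singleton]
  simp only [PMF.uniformOfFintype_toMeasure_singleton, Finset.prod_const, Finset.card_univ,
    Fintype.card_fin]
  exact h.ne

theorem map_val_condMeasureOn {X : Type*} [MeasurableSpace X] (μ : Measure X) {A : Set X}
    (hA : MeasurableSet A) :
    (condMeasureOn μ A).map Subtype.val = ProbabilityTheory.cond μ A := by
  rw [condMeasureOn, (MeasurableEmbedding.subtype_coe hA).map_comap, Subtype.range_coe,
    ProbabilityTheory.cond, Measure.restrict_smul, Measure.restrict_restrict hA, Set.inter_self]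

theorem condMeasureOn_univ {X : Type*} [MeasurableSpace X] (μ : Measure X)
    [IsProbabilityMeasure μ] :
    condMeasureOn μ Set.univ = μ.map (MeasurableEquiv.Set.univ X).symm := by
  have h := map_val_condMeasureOn μ MeasurableSet.univ
  rw [cond_univ] at h
  conv_rhs => rw [← h]
  rw [Measure.map_map (MeasurableEquiv.measurable _) measurable_subtype_coe]
  exact Measure.map_id.symm

/-- A measurable bijection of a set of positive measure with the whole space of another action
which is measure preserving and preserves orbits is a stable orbit equivalence. -/
theorem stablyOrbitEquivalent_of_measurableEquiv {G₁ G₂ : Type*} [Group G₁] [Group G₂]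
    {X₁ X₂ : Type*} [MeasurableSpace X₁] [MeasurableSpace X₂]
    {μ₁ : Measure X₁} {μ₂ : Measure X₂} [IsProbabilityMeasure μ₁] [IsProbabilityMeasure μ₂]
    (T : PMPAction G₁ μ₁) (S : PMPAction G₂ μ₂) {A : Set X₁} (hA : MeasurableSet A)
    (hA0 : 0 < μ₁ A) (φ : A ≃ᵐ X₂) (hφ : MeasurePreserving φ (condMeasureOn μ₁ A) μ₂)
    (h : ∀ᵐ x : A ∂(condMeasureOn μ₁ A), ∀ x' : A,
      (x' : X₁) ∈ T.orbit x ↔ φ x' ∈ S.orbit (φ x)) :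
    StablyOrbitEquivalent T S := by
  refine ⟨A, Set.univ, hA, .univ, hA0, by simp, φ.trans (MeasurableEquiv.Set.univ X₂).symm,
    ?_, ?_⟩
  · refine MeasurePreserving.trans hφ ?_
    rw [condMeasureOn_univ]
    exact (MeasurableEquiv.measurable _).measurePreserving _
  · filter_upwards [h] with x hx
    ext y
    constructor
    · rintro ⟨x', hx', rfl⟩
      exact (hx x').1 hx'
    · intro hy
      refine ⟨φ.symm y, (hx _).2 ?_, Subtype.ext ?_⟩
      · rw [φ.apply_symm_apply]; exact hy
      · exact φ.apply_symm_apply _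

/-- The isomorphism composes the increments, the straightening and the coset grouping. A return to
the base set means vanishing potential, which straightening turns into membership in the kernel of
`count`. -/
theorem cosetShift_stablyOrbitEquivalent {K : Type*} [MeasurableSpace K]
    [DiscreteMeasurableSpace K] {m : ℕ} (e : K ≃ ZMod (m + 1)) (κ : Measure K)
    [IsProbabilityMeasure κ] (hκ : ∀ v, κ {v} = ((m + 1 : ℕ) : ENNReal)⁻¹) :
    StablyOrbitEquivalent (cosetShift κ)
      (bernoulliShift (FreeGroup (Fin (m + 1 + 1))) (Measure.infinitePi fun _ : Fin (m + 1) =>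
        (PMF.uniformOfFintype (ZMod (m + 1) × ZMod (m + 1))).toMeasure)) := by
  set ω := (PMF.uniformOfFintype (ZMod (m + 1) × ZMod (m + 1))).toMeasure with hω
  obtain ⟨Ψ, hΨ, hae⟩ := exists_equiv_straightening ω (n := m + 1) measurable_fst
    uniform_preimage_fst_singleton
  have hA := measurableSet_cosetBase e
  have hval := map_val_condMeasureOn (cosetMeasure κ) hA
  have hinc : MeasurePreserving (cosetBaseEquiv e) (condMeasureOn (cosetMeasure κ) (cosetBase e))
      (Measure.infinitePi fun _ => ω) := by
    refine ⟨(cosetBaseEquiv e).measurable, ?_⟩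
    rw [← map_cosetIncrement_cond e κ hκ ω PMF.uniformOfFintype_toMeasure_singleton, ← hval,
      Measure.map_map (measurable_cosetIncrement e) measurable_subtype_coe]
    rfl
  refine stablyOrbitEquivalent_of_measurableEquiv _ _ hA
    (by rw [cosetMeasure_cosetBase e κ hκ]; simp)
    ((cosetBaseEquiv e).trans (Ψ.trans (kernelLabel m)))
    (hinc.trans (hΨ.trans (measurePreserving_kernelLabel m ω))) ?_
  filter_upwards [hinc.quasiMeasurePreserving.ae hae] with z ⟨θ, hθ, hz⟩ z'
  simp only [MeasurableEquiv.trans_apply]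
  constructor
  · rintro ⟨g, hg⟩
    -- Acting by g translates the argument by g⁻¹; surjectivity of θ expresses this as a translation
    -- by k after straightening.
    obtain ⟨k, hk⟩ := hθ g⁻¹
    have hg' : (fun h => z.1 (θ k * h)) = z'.1 := by rw [hk]; exact hg
    obtain ⟨h1, h2⟩ := hz k
    have h0 : FreeGroup.count (m + 1) k = 0 := by
      rw [← h2]
      exact (translate_mem_cosetBase_iff e z.2 _).1 (hg' ▸ z'.2)
    obtain ⟨h', rfl⟩ := exists_kernelHom_eq m h0
    refine ⟨h'⁻¹, ?_⟩
    have h3 : cosetBaseEquiv e z' = fun h => cosetBaseEquiv e z (θ (kernelHom m h') * h) := by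
      simp only [cosetBaseEquiv_apply]
      rw [← cosetIncrement_translate, hg']
    rw [h3, h1, kernelLabel_translate]
    simp only [bernoulliShift, inv_inv]
  · rintro ⟨h', hh⟩
    obtain ⟨h1, h2⟩ := hz (kernelHom m h'⁻¹)
    refine ⟨(θ (kernelHom m h'⁻¹))⁻¹, ?_⟩
    rw [count_kernelHom] at h2
    -- Count zero brings the translate back to the base set, where it can be compared with z' by
    -- injectivity.
    have hmem := (translate_mem_cosetBase_iff e z.2 (θ (kernelHom m h'⁻¹))).2 h2
    have h3 : cosetBaseEquiv e ⟨_, hmem⟩ = cosetBaseEquiv e z' := by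
      refine Ψ.injective ((kernelLabel m).injective ?_)
      rw [← hh, cosetBaseEquiv_apply]
      simp only [cosetIncrement_translate]
      simp only [← cosetBaseEquiv_apply]
      rw [h1, kernelLabel_translate]
      rfl
    have h4 := congrArg Subtype.val ((cosetBaseEquiv e).injective h3)
    simpa only [cosetShift, inv_inv] using h4

theorem theorem1p4 (K : Type*) [Fintype K] [Nontrivial K]
    [MeasurableSpace K] [DiscreteMeasurableSpace K] :
    ∃ (L : Type) (_ : MeasurableSpace L) (_ : StandardBorelSpace L)
      (lam : Measure L) (_ : IsProbabilityMeasure lam),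
      (∀ l : L, lam {l} ≠ 1) ∧
      StablyOrbitEquivalent
        (cosetShift (PMF.uniformOfFintype K).toMeasure)
        (bernoulliShift (FreeGroup (Fin (Fintype.card K + 1))) lam) := by
  obtain ⟨m, hm⟩ := Nat.exists_eq_succ_of_ne_zero (Fintype.card_ne_zero (α := K))
  have e : K ≃ ZMod (m + 1) := Fintype.equivOfCardEq (by rw [hm, ZMod.card])
  have : Nontrivial (ZMod (m + 1)) := e.symm.nontrivial
  refine ⟨Fin (m + 1) → ZMod (m + 1) × ZMod (m + 1), inferInstance, inferInstance,
    Measure.infinitePi fun _ => (PMF.uniformOfFintype (ZMod (m + 1) × ZMod (m + 1))).toMeasure,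
    inferInstance, infinitePi_uniform_singleton_ne_one m, ?_⟩
  rw [hm]
  exact cosetShift_stablyOrbitEquivalent e _ fun v => by
    rw [PMF.uniformOfFintype_toMeasure_singleton, hm]
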